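/- Let $\kappa\in(0,1)$ and $\lambda=\sqrt{1-\kappa^2}$, and let $\alpha,\beta\in(0,\pi/2)$ be the acute angles with $\kappa=\cos\alpha$ and $\lambda=\cos\beta$. For a modulus $\mu\in(0,1)$ put $f_\mu(T)=\int_0^T {}_2F_1\big(\tfrac14,\tfrac34;\tfrac12;\mu^2\sin^2t\big)\,dt$ for complex $T$ near $0$, let $\phi_\mu$ be the analytic local inverse of $f_\mu$ at $0$ with $\phi_\mu(0)=0$, and let $\psi_\mu$ be the analytic function near $0$ with $\psi_\mu(0)=0$ and $\sin\psi_\mu=\mu\sin\phi_\mu$. **Theorem.** For each $\mu\in\{\kappa,\lambda\}$ there is a unique meromorphic function $d_\mu$ on $\mathbb C$ with $d_\mu=\cos\psi_\mu$ near $0$, and there is a unique pair of real numbers $K_\mu>0$, $K'_\mu>0$ such that $2K_\mu$ and $2iK'_\mu$ are fundamental periods of $d_\mu$ (that is, the set of periods of $d_\mu$ is $2K_\mu\mathbb Z+2iK'_\mu\mathbb Z$). They satisfy $$K_\kappa=I(\beta),\qquad K'_\kappa=\sqrt2\,I(\alpha),\qquad\text{where}\quad I(\gamma)=\int_0^\gamma\frac{\cos\frac12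 t}{\sqrt{\cos^2t-\cos^2\gamma}}\,dt .$$ Consequently $$K'_\kappa=\sqrt2\,K_\lambda\qquad\text{and}\qquad K'_\lambda=\sqrt2\,K_\kappa .$$ -/

import Mathlib

namespace SignatureFour

/-- The function `f(T) = ∫₀^T F(1/4, 3/4; 1/2; κ² sin² t) dt` with modulus `κ`, for complex `T`
near `0`: the integral is taken along the segment from `0` to `T`, parametrized as `t = s * T`
with `0 ≤ s ≤ 1`. -/
noncomputable def f (κ : ℝ) (T : ℂ) : ℂ :=
  T * ∫ s in (0 : ℝ)..1,
    ₂F₁ (1 / 4 : ℂ) (3 / 4 : ℂ) (1 / 2 : ℂ) ((κ : ℂ) ^ 2 * Complex.sin ((s : ℂ) * T) ^ 2)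

/-- `φ` is (near `0`) the analytic inverse of `f κ` with `φ 0 = 0`. -/
structure IsPhi (κ : ℝ) (φ : ℂ → ℂ) : Prop where
  analyticAt : AnalyticAt ℂ φ 0
  map_zero : φ 0 = 0
  left_inverse : ∀ᶠ T in nhds (0 : ℂ), φ (f κ T) = T
  right_inverse : ∀ᶠ z in nhds (0 : ℂ), f κ (φ z) = z

/-- `ψ` is (near `0`) the analytic function with `ψ 0 = 0` and `sin ψ = κ sin φ`. -/
structure IsPsi (κ : ℝ) (φ ψ : ℂ → ℂ) : Prop where
  analyticAt : AnalyticAt ℂ ψ 0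
  map_zero : ψ 0 = 0
  sin_eq : ∀ᶠ z in nhds (0 : ℂ), Complex.sin (ψ z) = (κ : ℂ) * Complex.sin (φ z)

/-- `d` is the meromorphic function on the whole complex plane that is given near `0` by
`d = cos ψ`. Meromorphic functions are represented by total functions in normal form: removable
singularities are removed, and the value at a pole is `0` by convention. -/
structure IsD (κ : ℝ) (d : ℂ → ℂ) : Prop where
  meromorphic : MeromorphicNFOn d Set.univ
  eq_cos_psi : ∃ φ ψ : ℂ → ℂ, IsPhi κ φ ∧ IsPsi κ φ ψ ∧
    ∀ᶠ z in nhds (0 : ℂ), d z = Complex.cos (ψ z)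

/-- `K > 0` and `K' > 0` are real numbers such that `2 K` and `2 i K'` are fundamental periods
of `d`: the periods of `d` are exactly their integral linear combinations. -/
structure IsHalfPeriods (d : ℂ → ℂ) (K K' : ℝ) : Prop where
  pos : 0 < K
  pos' : 0 < K'
  periodic_iff : ∀ ω : ℂ, Function.Periodic d ω ↔
    ∃ m n : ℤ, ω = (m : ℂ) * (2 * (K : ℂ)) + (n : ℂ) * (2 * Complex.I * (K' : ℂ))

/-- `I(γ) = ∫₀^γ cos (t / 2) / √(cos² t - cos² γ) dt`. -/
noncomputable def I (γ : ℝ) : ℝ :=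
  ∫ t in (0 : ℝ)..γ, Real.cos (t / 2) / √(Real.cos t ^ 2 - Real.cos γ ^ 2)

end SignatureFour

open Filter Topology Complex
open scoped ComplexConjugate

namespace SignatureFour

/-! The hypergeometric function is elementary here: near `0`, F(1/4, 3/4; 1/2; sin² z) = cos(z/2) /
cos z (`hypergeometric_sin_sq`). Hence φ' = cos ψ / cos(ψ/2), and s = √2 sin(ψ/2) satisfies s'' = s³
- s with first integral 2 s'² = (1 - s²)² - λ², while cos ψ = 1 - s² (`isGerm_of_isPhi_isPsi`,
`IsGerm.energy`). So d is a rational function of an elliptic function, which is handled through its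
differential equation alone.

Global continuation comes from a 2-isogeny between the complementary moduli (`IsGerm.isogeny`): if t
is the germ for λ, then iκ t/t' evaluated at v/(√2 i) is the germ for κ. This enlarges the disc of
meromorphy by √2 and exchanges κ and λ, so iteration reaches all of ℂ.

On the positive real axis s rises to a first turning point K, and the substitution sin(θ/2) = s/√2
turns K into the integral I(β) (`eq_I_of_first_zero`). Reflection in K together with evenness gives
the period 2K. On the imaginary axis the isogeny expresses d through the λ-germ T; the turning point
I(α) of T becomes a pole of d at i√2 I(α), and 2i√2 I(α) is a period. Finally `isHalfPeriods_of`
excludes any further periods, using evenness, reality and the values of d on the two half-period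
segments. -/

/-! ### Closed form of the hypergeometric function -/

/-- Duplication: (1/2)₂ₙ = 4ⁿ (1/4)ₙ (3/4)ₙ and (2n)! = 4ⁿ n! (1/2)ₙ. This identifies the
hypergeometric coefficients with the even binomial coefficients of (1 - x)^(-1/2). -/
theorem half_pochhammer_even (n : ℕ) :
    ((2 * n).factorial : ℂ)⁻¹ * (ascPochhammer ℂ (2 * n)).eval (1 / 2) =
      (n.factorial : ℂ)⁻¹ * (ascPochhammer ℂ n).eval (1 / 4) * (ascPochhammer ℂ n).eval (3 / 4) *
        ((ascPochhammer ℂ n).eval (1 / 2))⁻¹ := by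
  induction n with
  | zero => simp
  | succ n ih =>
    have h1 : ((n : ℂ) + 1) ≠ 0 := by exact_mod_cast n.succ_ne_zero
    have h2 : (2 * (n : ℂ) + 1) ≠ 0 := by exact_mod_cast (2 * n).succ_ne_zero
    have h3 : (1 / 2 + (n : ℂ)) ≠ 0 := by
      intro h; apply h2; linear_combination 2 * h
    have h4 : (2 * (n : ℂ) + 1 + 1) ≠ 0 := by exact_mod_cast (2 * n + 1).succ_ne_zero
    rw [show 2 * (n + 1) = 2 * n + 1 + 1 by ring]
    simp only [ascPochhammer_succ_eval, Nat.factorial_succ]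
    push_cast
    rw [show (((2 : ℂ) * n + 1 + 1) * ((2 * n + 1) * ((2 * n).factorial : ℂ)))⁻¹ *
        ((ascPochhammer ℂ (2 * n)).eval (1 / 2) * (1 / 2 + 2 * (n : ℂ)) * (1 / 2 + (2 * n + 1))) =
        (((2 * n).factorial : ℂ)⁻¹ * (ascPochhammer ℂ (2 * n)).eval (1 / 2)) *
          ((1 / 2 + 2 * (n : ℂ)) * (1 / 2 + (2 * n + 1)) / ((2 * n + 1 + 1) * (2 * n + 1))) by
        simp only [mul_inv, div_eq_mul_inv]; ring, ih]
    simp only [mul_inv]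
    have h5 : (1 / 2 + 2 * (n : ℂ)) * (1 / 2 + (2 * n + 1)) / ((2 * n + 1 + 1) * (2 * n + 1)) =
      ((n : ℂ) + 1)⁻¹ * (1 / 4 + n) * (3 / 4 + n) * (1 / 2 + (n : ℂ))⁻¹ := by
      rw [show (1 / 2 + (n : ℂ)) = (2 * n + 1) / 2 by ring]
      field_simp
      ring
    rw [h5]
    ring

theorem hasSum_one_sub_cpow {x : ℂ} (hx : ‖x‖ < 1) :
    HasSum (fun n : ℕ => ((n.factorial : ℂ)⁻¹ * (ascPochhammer ℂ n).eval (1 / 2)) * x ^ n)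
      ((1 - x) ^ (-(1 / 2) : ℂ)) := by
  have h := (one_add_cpow_hasFPowerSeriesOnBall_zero (a := (-(1 / 2) : ℂ))).hasSum
    (y := -x) (by simpa [Metric.mem_eball, edist_zero_right, enorm_eq_nnnorm, ← NNReal.coe_lt_coe]
      using hx)
  -- The parameter `b` occurs both above and below and cancels; any value that is not a nonpositive
  -- integer would do.
  rw [binomialSeries_eq_ordinaryHypergeometricSeries (b := (1 : ℂ))
    (by intro k hk; have : ((k + 1 : ℕ) : ℂ) = 0 := by push_cast; rw [hk]; ring
        exact absurd this (by exact_mod_cast k.succ_ne_zero))] at h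
  have e : (1 - x) = 1 + (0 + -x) := by ring
  rw [e]
  refine Eq.mpr ?_ h
  congr 1
  funext n
  rw [FormalMultilinearSeries.compContinuousLinearMap_apply]
  have : ((⇑(-(ContinuousLinearMap.id ℂ ℂ)) : ℂ → ℂ) ∘ fun _ : Fin n => -x) = fun _ => x := by
    ext; simp
  rw [this, ordinaryHypergeometricSeries_apply_eq]
  have h1 : (ascPochhammer ℂ n).eval 1 ≠ 0 := by
    rw [ascPochhammer_eval_one]; exact_mod_cast n.factorial_ne_zero
  rw [mul_assoc _ _ ((ascPochhammer ℂ n).eval 1)⁻¹]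
  rw [mul_inv_cancel₀ h1]
  norm_num

/-- Averaging the binomial series at x and -x kills the odd terms. -/
theorem hypergeometric_sq {x : ℂ} (hx : ‖x‖ < 1) :
    ₂F₁ (1 / 4 : ℂ) (3 / 4 : ℂ) (1 / 2 : ℂ) (x ^ 2) =
      ((1 - x) ^ (-(1 / 2) : ℂ) + (1 + x) ^ (-(1 / 2) : ℂ)) / 2 := by
  have h := ((hasSum_one_sub_cpow hx).add (hasSum_one_sub_cpow (x := -x) (by simpa))).div_const 2
  rw [sub_neg_eq_add] at h
  have hinj : Function.Injective (fun n : ℕ => 2 * n) := fun a b h => by simpa using h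
  rw [← hinj.hasSum_iff] at h
  · rw [ordinaryHypergeometric_eq_tsum]
    rw [← h.tsum_eq]
    refine tsum_congr fun n => ?_
    simp only [Function.comp, half_pochhammer_even, smul_eq_mul, ← pow_mul]
    rw [(even_two_mul n).neg_pow]
    ring
  · intro n hn
    have : Odd n := by
      rw [← Nat.not_even_iff_odd]
      rintro ⟨k, hk⟩
      exact hn ⟨k, by simp; omega⟩
    rw [this.neg_pow]
    ring

theorem hypergeometric_sin_sq :
    ∀ᶠ z in 𝓝 (0 : ℂ), ₂F₁ (1 / 4 : ℂ) (3 / 4 : ℂ) (1 / 2 : ℂ) (sin z ^ 2) =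
      cos (z / 2) / cos z := by
  have c1 : ContinuousAt (fun z : ℂ => ‖sin z‖) 0 := by fun_prop
  have c2 : ContinuousAt (fun z : ℂ => (cos (z / 2) + sin (z / 2)).re) 0 := by fun_prop
  have c3 : ContinuousAt (fun z : ℂ => (cos (z / 2) - sin (z / 2)).re) 0 := by fun_prop
  -- Since 1 ± sin z = (cos(z/2) ± sin(z/2))², positive real parts ensure that the principal square
  -- roots are cos(z/2) ± sin(z/2).
  filter_upwards [c1.eventually_lt (continuousAt_const (y := (1 : ℝ))) (by simp),
    continuousAt_const.eventually_lt (f := fun _ => (0 : ℝ)) c2 (by simp),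
    continuousAt_const.eventually_lt (f := fun _ => (0 : ℝ)) c3 (by simp)] with z h1 h2 h3
  rw [hypergeometric_sq h1]
  have hs : sin z = 2 * sin (z / 2) * cos (z / 2) := by rw [← sin_two_mul]; congr 1; ring
  have hc : cos z = cos (z / 2) ^ 2 - sin (z / 2) ^ 2 := by
    rw [← cos_two_mul']; congr 1; ring
  have hsc := sin_sq_add_cos_sq (z / 2)
  have e1 : 1 - sin z = (cos (z / 2) - sin (z / 2)) ^ 2 := by rw [hs]; linear_combination -hsc
  have e2 : 1 + sin z = (cos (z / 2) + sin (z / 2)) ^ 2 := by rw [hs]; linear_combination -hsc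
  have n2 : cos (z / 2) + sin (z / 2) ≠ 0 := by intro h; rw [h] at h2; simp at h2
  have n3 : cos (z / 2) - sin (z / 2) ≠ 0 := by intro h; rw [h] at h3; simp at h3
  rw [e1, e2, cpow_neg, cpow_neg, one_div, sq_cpow_two_inv h2, sq_cpow_two_inv h3, hc,
    show cos (z / 2) ^ 2 - sin (z / 2) ^ 2 =
      (cos (z / 2) - sin (z / 2)) * (cos (z / 2) + sin (z / 2)) by ring]
  field_simp
  ring

theorem analyticAt_hypergeometric :
    AnalyticAt ℂ (₂F₁ (1 / 4 : ℂ) (3 / 4 : ℂ) (1 / 2 : ℂ) : ℂ → ℂ) 0 := by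
  have hr : (ordinaryHypergeometricSeries ℂ (1 / 4 : ℂ) (3 / 4 : ℂ) (1 / 2 : ℂ)).radius = 1 := by
    apply ordinaryHypergeometricSeries_radius_eq_one
    intro k
    have hk : (0 : ℝ) ≤ k := k.cast_nonneg
    refine ⟨?_, ?_, ?_⟩ <;> intro h <;> have := congrArg re h <;> norm_num at this <;> linarith
  exact ((ordinaryHypergeometricSeries ℂ (1 / 4 : ℂ) (3 / 4 : ℂ) (1 / 2 : ℂ)).hasFPowerSeriesOnBall
    (by rw [hr]; exact zero_lt_one)).analyticAt

/-! ### The integral `f` as a primitive near 0 -/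

/-- The integrand of `f`. -/
noncomputable def integrand (κ : ℝ) (t : ℂ) : ℂ :=
  ₂F₁ (1 / 4 : ℂ) (3 / 4 : ℂ) (1 / 2 : ℂ) ((κ : ℂ) ^ 2 * sin t ^ 2)

theorem analyticAt_integrand (κ : ℝ) : AnalyticAt ℂ (integrand κ) 0 := by
  have : AnalyticAt ℂ (fun t : ℂ => (κ : ℂ) ^ 2 * sin t ^ 2) 0 := by fun_prop
  exact AnalyticAt.fun_comp (f := fun t : ℂ => (κ : ℂ) ^ 2 * sin t ^ 2)
    (g := (₂F₁ (1 / 4 : ℂ) (3 / 4 : ℂ) (1 / 2 : ℂ) : ℂ → ℂ))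
    (by simpa only [sin_zero, ne_eq, OfNat.ofNat_ne_zero, not_false_eq_true, zero_pow, mul_zero]
      using analyticAt_hypergeometric) this

theorem hasDerivAt_f (κ : ℝ) : ∀ᶠ T in 𝓝 (0 : ℂ), HasDerivAt (f κ) (integrand κ T) T := by
  obtain ⟨r, hr, han⟩ := (Metric.eventually_nhds_iff_ball).1
    (analyticAt_integrand κ).eventually_analyticAt
  have hd : DifferentiableOn ℂ (integrand κ) (Metric.ball 0 r) :=
    fun z hz => (han z hz).differentiableAt.differentiableWithinAt
  obtain ⟨P, hP⟩ := hd.isExactOn_ball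
  have key : ∀ T ∈ Metric.ball (0 : ℂ) r, f κ T = P T - P 0 := by
    intro T hT
    have hmem : ∀ s ∈ Set.uIcc (0 : ℝ) 1, (s : ℂ) * T ∈ Metric.ball (0 : ℂ) r := by
      intro s hs
      rw [Set.uIcc_of_le zero_le_one] at hs
      rw [mem_ball_zero_iff] at hT ⊢
      rw [norm_mul, norm_real, Real.norm_of_nonneg hs.1]
      exact (mul_le_of_le_one_left (norm_nonneg _) hs.2).trans_lt hT
    have h1 : ∀ s ∈ Set.uIcc (0 : ℝ) 1,
        HasDerivAt (fun s : ℝ => P ((s : ℂ) * T)) (T * integrand κ ((s : ℂ) * T)) s := by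
      intro s hs
      have h2 : HasDerivAt (fun z : ℂ => P (z * T)) (integrand κ ((s : ℂ) * T) * (1 * T)) (s : ℂ) :=
        HasDerivAt.comp (s : ℂ) (hP _ (hmem s hs)) ((hasDerivAt_id (s : ℂ)).mul_const T)
      convert h2.comp_ofReal using 1
      ring
    have h3 := intervalIntegral.integral_eq_sub_of_hasDerivAt h1 (by
      apply ContinuousOn.intervalIntegrable
      refine continuousOn_const.mul (hd.continuousOn.comp (by fun_prop) hmem))
    rw [intervalIntegral.integral_const_mul] at h3
    simp only [ofReal_one, one_mul, ofReal_zero, zero_mul] at h3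
    exact h3
  filter_upwards [Metric.ball_mem_nhds (0 : ℂ) hr] with T hT
  refine ((hP T hT).sub_const (P 0)).congr_of_eventuallyEq ?_
  filter_upwards [Metric.isOpen_ball.mem_nhds hT] with z hz using key z hz

theorem f_zero (κ : ℝ) : f κ 0 = 0 := by simp [f]

theorem integrand_zero (κ : ℝ) : integrand κ 0 = 1 := by simp [integrand]

theorem analyticAt_f (κ : ℝ) : AnalyticAt ℂ (f κ) 0 := by
  rw [Complex.analyticAt_iff_eventually_differentiableAt]
  exact (hasDerivAt_f κ).mono fun _ h => h.differentiableAt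

/-! ### The germ √2 sin(ψ/2) and its differential equation -/

/-- `s` is analytic near `0` and solves `s'' = s ^ 3 - s`, `s 0 = 0`, `s' 0 = κ / √2` there. -/
structure IsGerm (κ : ℝ) (s : ℂ → ℂ) : Prop where
  analyticAt : AnalyticAt ℂ s 0
  map_zero : s 0 = 0
  deriv_zero : deriv s 0 = κ / (√2 : ℝ)
  ode : ∀ᶠ z in 𝓝 (0 : ℂ), deriv (deriv s) z = s z ^ 3 - s z

theorem sqrt_two_sq : ((√2 : ℝ) : ℂ) ^ 2 = 2 := by
  rw [← ofReal_pow, Real.sq_sqrt zero_le_two]; simp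

theorem sqrt_two_ne_zero : ((√2 : ℝ) : ℂ) ≠ 0 := by
  simp

theorem exists_isPhi (κ : ℝ) : ∃ φ, IsPhi κ φ := by
  have ha := analyticAt_f κ
  have hd : deriv (f κ) 0 ≠ 0 := by
    rw [(hasDerivAt_f κ).self_of_nhds.deriv, integrand_zero]; exact one_ne_zero
  have h := ha.hasStrictDerivAt
  refine ⟨h.localInverse _ _ _ hd, ?_, ?_, ?_, ?_⟩
  · simpa [f_zero] using ha.analyticAt_localInverse hd
  · have := (h.hasStrictFDerivAt_equiv hd).localInverse_apply_image
    rwa [f_zero] at this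
  · exact (h.hasStrictFDerivAt_equiv hd).eventually_left_inverse
  · have := (h.hasStrictFDerivAt_equiv hd).eventually_right_inverse
    rwa [f_zero] at this

theorem exists_isPsi {κ : ℝ} {φ : ℂ → ℂ} (hφ : IsPhi κ φ) : ∃ ψ, IsPsi κ φ ψ := by
  have ha : AnalyticAt ℂ sin 0 := by fun_prop
  have hd : deriv sin (0 : ℂ) ≠ 0 := by simp
  have h := ha.hasStrictDerivAt
  have hφa := hφ.analyticAt
  have hg : AnalyticAt ℂ (fun z => (κ : ℂ) * sin (φ z)) 0 := by fun_prop
  have hg0 : (κ : ℂ) * sin (φ 0) = sin 0 := by simp [hφ.map_zero]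
  refine ⟨fun z => h.localInverse _ _ _ hd (κ * sin (φ z)), ?_, ?_, ?_⟩
  · refine AnalyticAt.fun_comp (f := fun z => (κ : ℂ) * sin (φ z)) ?_ hg
    simpa only [hg0] using ha.analyticAt_localInverse hd
  · have := (h.hasStrictFDerivAt_equiv hd).localInverse_apply_image
    simp only [hg0]
    exact this
  · have := (h.hasStrictFDerivAt_equiv hd).eventually_right_inverse
    have hc := hg.continuousAt.tendsto
    simp only [hg0] at hc
    exact hc.eventually this

/-- The integrand at φ is F(sin² ψ) = cos(ψ/2) / cos ψ, because κ sin φ = sin ψ. The two derivatives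
follow by differentiating f(φ(z)) = z and sin ψ = κ sin φ. -/
theorem IsPhi.hasDerivAt {κ : ℝ} {φ ψ : ℂ → ℂ} (hφ : IsPhi κ φ) (hψ : IsPsi κ φ ψ) :
    ∀ᶠ z in 𝓝 (0 : ℂ), cos (ψ z) ≠ 0 ∧ cos (ψ z / 2) ≠ 0 ∧
      HasDerivAt φ (cos (ψ z) / cos (ψ z / 2)) z ∧
      HasDerivAt ψ (κ * cos (φ z) / cos (ψ z / 2)) z := by
  have hφc : Tendsto φ (𝓝 0) (𝓝 0) := by
    simpa [hφ.map_zero] using hφ.analyticAt.continuousAt.tendsto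
  have hψc : Tendsto ψ (𝓝 0) (𝓝 0) := by
    simpa [hψ.map_zero] using hψ.analyticAt.continuousAt.tendsto
  have c1 : ∀ᶠ z in 𝓝 (0 : ℂ), cos z ≠ 0 := continuous_cos.continuousAt.eventually_ne (by simp)
  have c2 : ∀ᶠ z in 𝓝 (0 : ℂ), cos (z / 2) ≠ 0 :=
    ContinuousAt.eventually_ne (g := fun z : ℂ => cos (z / 2)) (by fun_prop) (by simp)
  filter_upwards [hψc.eventually c1, hψc.eventually c2, hψc.eventually hypergeometric_sin_sq,
    hφc.eventually (hasDerivAt_f κ), hφ.right_inverse.eventually_nhds,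
    hφ.analyticAt.eventually_analyticAt, hψ.analyticAt.eventually_analyticAt,
    hψ.sin_eq.eventually_nhds] with z h1 h2 h3 h4 h5 h6 h7 h8
  have e : integrand κ (φ z) = cos (ψ z / 2) / cos (ψ z) := by
    rw [integrand, ← mul_pow, ← h8.self_of_nhds, h3]
  have k1 : HasDerivAt φ (cos (ψ z) / cos (ψ z / 2)) z := by
    have a := h4.comp z h6.differentiableAt.hasDerivAt
    have b := a.unique ((hasDerivAt_id z).congr_of_eventuallyEq h5)
    rw [e] at b
    have : deriv φ z = cos (ψ z) / cos (ψ z / 2) := by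
      field_simp at b ⊢
      linear_combination b
    rw [← this]
    exact h6.differentiableAt.hasDerivAt
  refine ⟨h1, h2, k1, ?_⟩
  have a := h7.differentiableAt.hasDerivAt.csin
  have b := a.unique ((k1.csin.const_mul (κ : ℂ)).congr_of_eventuallyEq h8)
  have : deriv ψ z = κ * cos (φ z) / cos (ψ z / 2) := by
    field_simp at b ⊢
    exact b
  rw [← this]
  exact h7.differentiableAt.hasDerivAt

/-- The factor cos(ψ/2) cancels in the first derivative, leaving κ cos φ / √2. In the second, κ sin
φ = sin ψ = 2 sin(ψ/2) cos(ψ/2) cancels it again. -/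
theorem isGerm_of_isPhi_isPsi {κ : ℝ} {φ ψ : ℂ → ℂ} (hφ : IsPhi κ φ) (hψ : IsPsi κ φ ψ) :
    IsGerm κ (fun z => (√2 : ℝ) * sin (ψ z / 2)) := by
  have hd : ∀ᶠ z in 𝓝 (0 : ℂ), HasDerivAt (fun z => ((√2 : ℝ) : ℂ) * sin (ψ z / 2))
      (κ / (√2 : ℝ) * cos (φ z)) z := by
    filter_upwards [hφ.hasDerivAt hψ] with z ⟨h1, h2, h3, h4⟩
    refine ((h4.div_const 2).csin.const_mul ((√2 : ℝ) : ℂ)).congr_deriv ?_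
    have := sqrt_two_ne_zero
    field_simp
    rw [sqrt_two_sq]
  have ha := hψ.analyticAt
  refine ⟨by fun_prop, by simp [hψ.map_zero], ?_, ?_⟩
  · rw [hd.self_of_nhds.deriv, hφ.map_zero]; simp
  · have hd' : deriv (fun z => ((√2 : ℝ) : ℂ) * sin (ψ z / 2)) =ᶠ[𝓝 0]
        fun z => κ / (√2 : ℝ) * cos (φ z) := hd.mono fun z hz => hz.deriv
    filter_upwards [hd'.eventually_nhds, hφ.hasDerivAt hψ, hψ.sin_eq] with z h0 ⟨h1, h2, h3, h4⟩ h5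
    rw [((h3.ccos.const_mul (κ / ((√2 : ℝ) : ℂ))).congr_of_eventuallyEq h0).deriv]
    have e1 : sin (ψ z) = 2 * sin (ψ z / 2) * cos (ψ z / 2) := by
      rw [← sin_two_mul]; congr 1; ring
    have e2 : cos (ψ z) = 1 - 2 * sin (ψ z / 2) ^ 2 := by
      rw [← cos_two_mul_eq_one_sub]; congr 1; ring
    have := sqrt_two_ne_zero
    have e3 : (κ : ℂ) * sin (φ z) * cos (ψ z) / cos (ψ z / 2) =
        2 * sin (ψ z / 2) * cos (ψ z) := by
      rw [← h5, e1]; field_simp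
    have e4 : (κ : ℂ) / (√2 : ℝ) * (-sin (φ z) * (cos (ψ z) / cos (ψ z / 2))) =
        - (κ * sin (φ z) * cos (ψ z) / cos (ψ z / 2)) / (√2 : ℝ) := by field_simp
    rw [e4, e3, e2, div_eq_iff this]
    linear_combination (sin (ψ z / 2) - sin (ψ z / 2) ^ 3 * ((√2 : ℝ) ^ 2 + 2)) * sqrt_two_sq

theorem cos_eq_one_sub_sq (w : ℂ) : cos w = 1 - (((√2 : ℝ) : ℂ) * sin (w / 2)) ^ 2 := by
  rw [mul_pow, sqrt_two_sq, ← cos_two_mul_eq_one_sub]; congr 1; ring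

/-! ### Uniqueness of the germ -/

theorem eventually_const_of_deriv_eq_zero {g : ℂ → ℂ} {x : ℂ} (hg : AnalyticAt ℂ g x)
    (h : ∀ᶠ z in 𝓝 x, deriv g z = 0) : ∀ᶠ z in 𝓝 x, g z = g x := by
  have h1 := hg.analyticOrderAt_deriv_add_one
  rw [analyticOrderAt_eq_top.2 h, top_add, eq_comm, analyticOrderAt_eq_top] at h1
  exact h1.mono fun z hz => sub_eq_zero.1 hz

/-- The difference e satisfies e'' = q e with q analytic, so e'' vanishes at least to the order of
e. But e and e' vanish at x, so differentiating twice lowers a finite order by two; hence the order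
is infinite. -/
theorem ode_unique {s t : ℂ → ℂ} {x : ℂ} (hs : AnalyticAt ℂ s x) (ht : AnalyticAt ℂ t x)
    (h0 : s x = t x) (h1 : deriv s x = deriv t x)
    (hs2 : ∀ᶠ z in 𝓝 x, deriv (deriv s) z = s z ^ 3 - s z)
    (ht2 : ∀ᶠ z in 𝓝 x, deriv (deriv t) z = t z ^ 3 - t z) : s =ᶠ[𝓝 x] t := by
  set e : ℂ → ℂ := fun z => s z - t z with he
  have hea : AnalyticAt ℂ e x := by fun_prop
  have d1 : deriv e =ᶠ[𝓝 x] fun z => deriv s z - deriv t z := by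
    filter_upwards [hs.eventually_analyticAt, ht.eventually_analyticAt] with z hz hz'
    exact deriv_sub hz.differentiableAt hz'.differentiableAt
  have d2 : deriv (deriv e) =ᶠ[𝓝 x] fun z => (s z ^ 2 + s z * t z + t z ^ 2 - 1) * e z := by
    filter_upwards [d1.eventually_nhds, hs.deriv.eventually_analyticAt,
      ht.deriv.eventually_analyticAt, hs2, ht2] with z h hz hz' h3 h4
    rw [EventuallyEq.deriv_eq h, deriv_fun_sub hz.differentiableAt hz'.differentiableAt, h3, h4]
    simp only [he]; ring
  have o1 := hea.deriv.analyticOrderAt_deriv_add_one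
  have o2 := hea.analyticOrderAt_deriv_add_one
  have z0 : e x = 0 := by simp [he, h0]
  have z1 : deriv e x = 0 := by
    rw [d1.self_of_nhds]; exact sub_eq_zero.2 h1
  simp only [z0, z1, sub_zero] at o1 o2
  rw [analyticOrderAt_congr d2] at o1
  have o3 : analyticOrderAt (fun z => (s z ^ 2 + s z * t z + t z ^ 2 - 1) * e z) x =
      analyticOrderAt (fun z => s z ^ 2 + s z * t z + t z ^ 2 - 1) x + analyticOrderAt e x :=
    analyticOrderAt_mul (by fun_prop) hea
  rw [o3] at o1
  have o4 : analyticOrderAt e x = ⊤ := by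
    by_contra hne
    obtain ⟨n, hn⟩ := ENat.ne_top_iff_exists.1 hne
    have hl : analyticOrderAt e x + 1 ≤ analyticOrderAt e x := by
      calc analyticOrderAt e x + 1
          ≤ analyticOrderAt (fun z => s z ^ 2 + s z * t z + t z ^ 2 - 1) x +
              analyticOrderAt e x + 1 := by gcongr; exact le_add_self
        _ = analyticOrderAt (deriv e) x := o1
        _ ≤ analyticOrderAt (deriv e) x + 1 := le_self_add
        _ = analyticOrderAt e x := o2
    rw [← hn] at hl
    have : n + 1 ≤ n := by exact_mod_cast hl
    omega
  exact (analyticOrderAt_eq_top.1 o4).mono fun z hz => sub_eq_zero.1 hz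

theorem IsGerm.unique {κ : ℝ} {s t : ℂ → ℂ} (hs : IsGerm κ s) (ht : IsGerm κ t) :
    s =ᶠ[𝓝 0] t :=
  ode_unique hs.analyticAt ht.analyticAt (hs.map_zero.trans ht.map_zero.symm)
    (hs.deriv_zero.trans ht.deriv_zero.symm) hs.ode ht.ode

theorem IsGerm.energy {κ : ℝ} {s : ℂ → ℂ} (hs : IsGerm κ s) :
    ∀ᶠ z in 𝓝 (0 : ℂ), 2 * deriv s z ^ 2 = κ ^ 2 - 2 * s z ^ 2 + s z ^ 4 := by
  have ha := hs.analyticAt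
  have ha' := ha.deriv
  have h := eventually_const_of_deriv_eq_zero (x := 0)
    (g := fun z => 2 * deriv s z ^ 2 + 2 * s z ^ 2 - s z ^ 4) (by fun_prop) (by
      filter_upwards [ha.eventually_analyticAt, ha'.eventually_analyticAt, hs.ode] with z h1 h2 h3
      have k1 := h1.differentiableAt.hasDerivAt
      have k2 := h2.differentiableAt.hasDerivAt
      refine ((((k2.fun_pow 2).const_mul 2).fun_add ((k1.fun_pow 2).const_mul 2)).fun_sub
        (k1.fun_pow 4)).deriv.trans ?_
      rw [h3]
      push_cast
      ring)
  filter_upwards [h] with z hz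
  rw [hs.map_zero, hs.deriv_zero, div_pow, sqrt_two_sq] at hz
  linear_combination hz

theorem exists_isGerm (κ : ℝ) : ∃ s, IsGerm κ s := by
  obtain ⟨φ, hφ⟩ := exists_isPhi κ
  obtain ⟨ψ, hψ⟩ := exists_isPsi hφ
  exact ⟨_, isGerm_of_isPhi_isPsi hφ hψ⟩

/-- A function agrees near `0` with `cos ψ` if and only if it is `1 - s ^ 2` there. -/
theorem exists_phi_psi_iff {κ : ℝ} {s d : ℂ → ℂ} (hs : IsGerm κ s) :
    (∃ φ ψ : ℂ → ℂ, IsPhi κ φ ∧ IsPsi κ φ ψ ∧ ∀ᶠ z in 𝓝 (0 : ℂ), d z = cos (ψ z)) ↔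
      ∀ᶠ z in 𝓝 (0 : ℂ), d z = 1 - s z ^ 2 := by
  constructor
  · rintro ⟨φ, ψ, hφ, hψ, hd⟩
    filter_upwards [hd, hs.unique (isGerm_of_isPhi_isPsi hφ hψ)] with z h1 h2
    rw [h1, h2, cos_eq_one_sub_sq]
  · intro hd
    obtain ⟨φ, hφ⟩ := exists_isPhi κ
    obtain ⟨ψ, hψ⟩ := exists_isPsi hφ
    refine ⟨φ, ψ, hφ, hψ, ?_⟩
    filter_upwards [hd, hs.unique (isGerm_of_isPhi_isPsi hφ hψ)] with z h1 h2
    rw [h1, h2, cos_eq_one_sub_sq]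

/-! ### Identity theorem for meromorphic functions -/

theorem eventuallyEq_nhdsNE_of_eventuallyEq {f g : ℂ → ℂ} {U : Set ℂ} (hf : MeromorphicOn f U)
    (hg : MeromorphicOn g U) (hU : IsPreconnected U) {x y : ℂ} (hx : x ∈ U) (hy : y ∈ U)
    (h : f =ᶠ[𝓝[≠] x] g) : f =ᶠ[𝓝[≠] y] g := by
  by_contra hne
  have h1 : meromorphicOrderAt (f - g) y ≠ ⊤ := by
    intro htop
    exact hne (eventuallyEq_iff_sub.2 (meromorphicOrderAt_eq_top_iff.1 htop))
  exact (hf.sub hg).meromorphicOrderAt_ne_top_of_isPreconnected hU hy hx h1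
    (meromorphicOrderAt_eq_top_iff.2 (eventuallyEq_iff_sub.1 h))

/-- Normal form upgrades equality on punctured neighbourhoods to equality at every point, poles
included. -/
theorem eqOn_of_meromorphicNFOn {f g : ℂ → ℂ} {U : Set ℂ} (hf : MeromorphicNFOn f U)
    (hg : MeromorphicNFOn g U) (hU : IsPreconnected U) {x : ℂ} (hx : x ∈ U)
    (h : f =ᶠ[𝓝[≠] x] g) : Set.EqOn f g U := fun _ hy =>
  (((hf hy).eventuallyEq_nhdsNE_iff_eventuallyEq_nhds (hg hy)).1
    (eventuallyEq_nhdsNE_of_eventuallyEq hf.meromorphicOn hg.meromorphicOn hU hx hy h)).eq_of_nhds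

theorem eq_of_meromorphicNFOn {f g : ℂ → ℂ} (hf : MeromorphicNFOn f Set.univ)
    (hg : MeromorphicNFOn g Set.univ) {x : ℂ} (h : f =ᶠ[𝓝[≠] x] g) : f = g :=
  funext fun z => eqOn_of_meromorphicNFOn hf hg isPreconnected_univ (Set.mem_univ x) h
    (Set.mem_univ z)

theorem toMeromorphicNFOn_eventuallyEq {f : ℂ → ℂ} {U : Set ℂ} {x : ℂ} (hf : MeromorphicOn f U)
    (hx : x ∈ U) (ha : AnalyticAt ℂ f x) : toMeromorphicNFOn f U =ᶠ[𝓝 x] f :=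
  ((meromorphicNFOn_toMeromorphicNFOn f U hx).eventuallyEq_nhdsNE_iff_eventuallyEq_nhds
    ha.meromorphicNFAt).1 (hf.toMeromorphicNFOn_eq_self_on_nhdsNE hx)

/-- By the identity theorem the functions agree on smaller balls, so they glue: at z the index
⌈‖z‖⌉₊ is used, whose ball has radius exceeding ‖z‖. -/
theorem exists_meromorphicNFOn_univ_of_balls {g : ℕ → ℂ → ℂ}
    (hg : ∀ n : ℕ, MeromorphicNFOn (g n) (Metric.ball 0 (n + 1)))
    (h : ∀ n, g n =ᶠ[𝓝 0] g 0) :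
    ∃ G : ℂ → ℂ, MeromorphicNFOn G Set.univ ∧ G =ᶠ[𝓝 0] g 0 := by
  have mono : ∀ {m n : ℕ}, m ≤ n → Set.EqOn (g m) (g n) (Metric.ball 0 (m + 1)) := by
    intro m n hmn
    have hsub : Metric.ball (0 : ℂ) (m + 1) ⊆ Metric.ball 0 (n + 1) :=
      Metric.ball_subset_ball (by have : (m : ℝ) ≤ n := by exact_mod_cast hmn
                                  linarith)
    exact eqOn_of_meromorphicNFOn (hg m) (fun z hz => hg n (hsub hz))
      (convex_ball _ _).isPreconnected (x := 0) (Metric.mem_ball_self (by positivity))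
      (((h m).trans (h n).symm).filter_mono nhdsWithin_le_nhds)
  have hG : ∀ n : ℕ, Set.EqOn (fun z => g ⌈‖z‖⌉₊ z) (g n) (Metric.ball 0 (n + 1)) := by
    intro n z hz
    have hz' : z ∈ Metric.ball (0 : ℂ) (⌈‖z‖⌉₊ + 1) := by
      rw [mem_ball_zero_iff]; exact (Nat.le_ceil _).trans_lt (lt_add_one _)
    rcases le_total ⌈‖z‖⌉₊ n with hn | hn
    · exact mono hn hz'
    · exact (mono hn hz).symm
  have hG' : ∀ n : ℕ, ∀ z ∈ Metric.ball (0 : ℂ) (n + 1), (fun z => g ⌈‖z‖⌉₊ z) =ᶠ[𝓝 z] g n :=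
    fun n z hz => (hG n).eventuallyEq_of_mem (Metric.isOpen_ball.mem_nhds hz)
  refine ⟨fun z => g ⌈‖z‖⌉₊ z, fun z _ => ?_, hG' 0 0 (by simp)⟩
  have hz : z ∈ Metric.ball (0 : ℂ) (⌈‖z‖⌉₊ + 1) := by
    rw [mem_ball_zero_iff]; exact (Nat.le_ceil _).trans_lt (lt_add_one _)
  exact (meromorphicNFAt_congr (hG' _ z hz)).2 (hg _ hz)

/-! ### The isogeny between complementary moduli -/

/-- The factor `1 / (√2 i)`. -/
noncomputable def rot : ℂ := -Complex.I / (√2 : ℝ)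

theorem I_mul_rot : Complex.I * rot = 1 / (√2 : ℝ) := by
  rw [rot, ← mul_div_assoc, mul_neg, I_mul_I, neg_neg]

theorem rot_mul : rot * (√2 * Complex.I : ℂ) = 1 := by
  have := sqrt_two_ne_zero
  rw [rot]; field_simp; rw [I_sq]; ring

theorem norm_rot_mul (v : ℂ) : √2 * ‖rot * v‖ = ‖v‖ := by
  rw [rot, norm_mul, norm_div, norm_neg, norm_I, norm_real, Real.norm_of_nonneg (Real.sqrt_nonneg _)]
  have : √2 ≠ 0 := by positivity
  field_simp

theorem analyticAt_rot_mul (v : ℂ) : AnalyticAt ℂ (fun v => rot * v) v := by fun_prop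

theorem tendsto_rot_mul : Tendsto (fun v : ℂ => rot * v) (𝓝 0) (𝓝 0) := by
  have : ContinuousAt (fun v : ℂ => rot * v) 0 := by fun_prop
  simpa [ContinuousAt] using this

/-- By the energy relation for λ, u = t/t' satisfies u'' = 2κ²u³ + 2u. Since `rot` squares to -1/2,
the rescaling iκ u(`rot` v) turns this into s'' = s³ - s, with the slope κ/√2 at `0`. -/
theorem IsGerm.isogeny {κ lam : ℝ} (hκ : κ ^ 2 + lam ^ 2 = 1) (hlam : lam ≠ 0) {t : ℂ → ℂ}
    (ht : IsGerm lam t) :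
    IsGerm κ (fun v => Complex.I * κ * (t (rot * v) / deriv t (rot * v))) := by
  have hκ' : (κ : ℂ) ^ 2 = 1 - lam ^ 2 := by
    rw [eq_sub_iff_add_eq]; exact_mod_cast hκ
  have hta := ht.analyticAt
  have hta' := hta.deriv
  have hp0 : deriv t 0 ≠ 0 := by
    rw [ht.deriv_zero]; exact div_ne_zero (by exact_mod_cast hlam) sqrt_two_ne_zero
  have hpe : ∀ᶠ z in 𝓝 (0 : ℂ), deriv t z ≠ 0 := hta'.continuousAt.eventually_ne hp0
  have d1 : ∀ᶠ z in 𝓝 (0 : ℂ), HasDerivAt (fun z => t z / deriv t z)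
      ((deriv t z ^ 2 - t z ^ 4 + t z ^ 2) / deriv t z ^ 2) z := by
    filter_upwards [hta.eventually_analyticAt, hta'.eventually_analyticAt, ht.ode, hpe]
      with z h1 h2 h3 h4
    refine (h1.differentiableAt.hasDerivAt.fun_div h2.differentiableAt.hasDerivAt h4).congr_deriv ?_
    rw [h3]; ring
  have d2 : ∀ᶠ z in 𝓝 (0 : ℂ), HasDerivAt
      (fun z => (deriv t z ^ 2 - t z ^ 4 + t z ^ 2) / deriv t z ^ 2)
      (2 * κ ^ 2 * (t z / deriv t z) ^ 3 + 2 * (t z / deriv t z)) z := by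
    filter_upwards [hta.eventually_analyticAt, hta'.eventually_analyticAt, ht.ode, hpe, ht.energy]
      with z h1 h2 h3 h4 h5
    have k1 := h1.differentiableAt.hasDerivAt
    have k2 := h2.differentiableAt.hasDerivAt
    refine ((((k2.fun_pow 2).fun_sub (k1.fun_pow 4)).fun_add (k1.fun_pow 2)).fun_div (k2.fun_pow 2)
      (pow_ne_zero 2 h4)).congr_deriv ?_
    rw [h3, hκ']
    field_simp
    push_cast
    linear_combination (-2 * deriv t z * t z ^ 3) * h5
  have c : ∀ v : ℂ, HasDerivAt (fun v => rot * v) rot v := fun v => by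
    simpa using (hasDerivAt_id v).const_mul rot
  have e1 : ∀ᶠ v in 𝓝 (0 : ℂ), HasDerivAt
      (fun v => Complex.I * κ * (t (rot * v) / deriv t (rot * v)))
      (κ / (√2 : ℝ) * ((deriv t (rot * v) ^ 2 - t (rot * v) ^ 4 + t (rot * v) ^ 2) /
        deriv t (rot * v) ^ 2)) v := by
    filter_upwards [tendsto_rot_mul.eventually d1] with v hv
    refine ((HasDerivAt.comp v hv (c v)).const_mul (Complex.I * κ)).congr_deriv ?_
    linear_combination (κ * ((deriv t (rot * v) ^ 2 - t (rot * v) ^ 4 + t (rot * v) ^ 2) /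
        deriv t (rot * v) ^ 2)) * I_mul_rot
  have c0 : AnalyticAt ℂ (fun v => rot * v) 0 := by fun_prop
  refine ⟨?_, ?_, ?_, ?_⟩
  · refine analyticAt_const.mul (AnalyticAt.div ?_ ?_ (by simpa using hp0))
    · exact AnalyticAt.fun_comp (by simpa using hta) c0
    · exact AnalyticAt.fun_comp (by simpa using hta') c0
  · simp [ht.map_zero]
  · rw [e1.self_of_nhds.deriv]
    simp [ht.map_zero, hp0]
  · have e1' := e1.mono fun _ h => h.deriv
    filter_upwards [e1'.eventually_nhds, tendsto_rot_mul.eventually d2] with v h1 h2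
    refine (EventuallyEq.deriv_eq h1).trans ?_
    refine ((HasDerivAt.comp v h2 (c v)).const_mul ((κ : ℂ) / (√2 : ℝ))).deriv.trans ?_
    have e : (κ : ℂ) / (√2 : ℝ) * rot = -Complex.I * κ / 2 := by
      rw [rot, div_mul_div_comm, ← sq, sqrt_two_sq]; ring
    linear_combination (2 * κ ^ 2 * (t (rot * v) / deriv t (rot * v)) ^ 3 +
      2 * (t (rot * v) / deriv t (rot * v))) * e -
      (κ ^ 3 * (t (rot * v) / deriv t (rot * v)) ^ 3 * Complex.I) * I_sq

theorem exists_isGerm_meromorphicOn_sqrt_two_mul {κ lam : ℝ} (hκ : κ ^ 2 + lam ^ 2 = 1)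
    (hlam : lam ≠ 0) {R : ℝ}
    (h : ∃ t, IsGerm lam t ∧ MeromorphicOn t (Metric.ball 0 R)) :
    ∃ s, IsGerm κ s ∧ MeromorphicOn s (Metric.ball 0 (√2 * R)) := by
  obtain ⟨t, ht, hm⟩ := h
  refine ⟨_, ht.isogeny hκ hlam, fun v hv => ?_⟩
  have hv' : rot * v ∈ Metric.ball (0 : ℂ) R := by
    rw [mem_ball_zero_iff] at hv ⊢
    rw [← norm_rot_mul v] at hv
    exact lt_of_mul_lt_mul_left hv (Real.sqrt_nonneg _)
  have h1 := hm _ hv'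
  have a1 : MeromorphicAt (fun v => t (rot * v)) v := h1.comp_analyticAt (analyticAt_rot_mul v)
  have a2 : MeromorphicAt (fun v => deriv t (rot * v)) v :=
    h1.deriv.comp_analyticAt (analyticAt_rot_mul v)
  exact (MeromorphicAt.const _ _).fun_mul (a1.fun_div a2)

/-- The induction carries both moduli at once, since each isogeny step obtains one from the other
while multiplying the radius by √2. -/
theorem exists_isGerm_meromorphicOn_ball {κ lam : ℝ} (hκ : κ ^ 2 + lam ^ 2 = 1) (hκ0 : κ ≠ 0)
    (hlam : lam ≠ 0) (R : ℝ) : ∃ s, IsGerm κ s ∧ MeromorphicOn s (Metric.ball 0 R) := by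
  have base : ∀ μ : ℝ, ∃ r > 0, ∃ s, IsGerm μ s ∧ MeromorphicOn s (Metric.ball 0 r) := by
    intro μ
    obtain ⟨s, hs⟩ := exists_isGerm μ
    obtain ⟨r, hr, h⟩ := Metric.eventually_nhds_iff_ball.1 hs.analyticAt.eventually_analyticAt
    exact ⟨r, hr, s, hs, fun z hz => (h z hz).meromorphicAt⟩
  obtain ⟨r₁, hr₁, s₁, hs₁, hm₁⟩ := base κ
  obtain ⟨r₂, hr₂, s₂, hs₂, hm₂⟩ := base lam
  have key : ∀ n : ℕ,
      (∃ s, IsGerm κ s ∧ MeromorphicOn s (Metric.ball 0 (√2 ^ n * min r₁ r₂))) ∧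
      (∃ s, IsGerm lam s ∧ MeromorphicOn s (Metric.ball 0 (√2 ^ n * min r₁ r₂))) := by
    intro n
    induction n with
    | zero =>
      exact ⟨⟨s₁, hs₁, hm₁.mono_set (Metric.ball_subset_ball (by simp))⟩,
        ⟨s₂, hs₂, hm₂.mono_set (Metric.ball_subset_ball (by simp))⟩⟩
    | succ n ih =>
      rw [pow_succ', mul_assoc]
      exact ⟨exists_isGerm_meromorphicOn_sqrt_two_mul hκ hlam ih.2,
        exists_isGerm_meromorphicOn_sqrt_two_mul (by rw [add_comm]; exact hκ) hκ0 ih.1⟩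
  have h2 : 1 < √2 := by rw [Real.lt_sqrt] <;> norm_num
  have hr : 0 < min r₁ r₂ := lt_min hr₁ hr₂
  obtain ⟨n, hn⟩ := pow_unbounded_of_one_lt (R / min r₁ r₂) h2
  obtain ⟨s, hs, hm⟩ := (key n).1
  exact ⟨s, hs, hm.mono_set (Metric.ball_subset_ball ((div_lt_iff₀ hr).1 hn).le)⟩

theorem IsGerm.congr {κ : ℝ} {s t : ℂ → ℂ} (hs : IsGerm κ s) (h : t =ᶠ[𝓝 0] s) : IsGerm κ t where
  analyticAt := hs.analyticAt.congr h.symm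
  map_zero := h.eq_of_nhds.trans hs.map_zero
  deriv_zero := h.deriv_eq.trans hs.deriv_zero
  ode := by
    filter_upwards [h.deriv.deriv, h, hs.ode] with z h1 h2 h3
    rw [h1, h2, h3]

theorem exists_isGerm_meromorphicNFOn {κ lam : ℝ} (hκ : κ ^ 2 + lam ^ 2 = 1) (hκ0 : κ ≠ 0)
    (hlam : lam ≠ 0) : ∃ s, IsGerm κ s ∧ MeromorphicNFOn s Set.univ := by
  choose g hg hm using fun n : ℕ => exists_isGerm_meromorphicOn_ball hκ hκ0 hlam (n + 1)
  have h0 : ∀ n : ℕ, toMeromorphicNFOn (g n) (Metric.ball 0 (n + 1)) =ᶠ[𝓝 0] g n := fun n =>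
    toMeromorphicNFOn_eventuallyEq (hm n) (Metric.mem_ball_self (by positivity)) (hg n).analyticAt
  obtain ⟨G, hG, hG0⟩ := exists_meromorphicNFOn_univ_of_balls
    (g := fun n => toMeromorphicNFOn (g n) (Metric.ball 0 (n + 1)))
    (fun n => meromorphicNFOn_toMeromorphicNFOn _ _)
    (fun n => ((h0 n).trans ((hg n).unique (hg 0))).trans (h0 0).symm)
  exact ⟨G, (hg 0).congr (hG0.trans (h0 0)), hG⟩

/-! ### Real solutions up to the first turning point -/

/-- If the velocity p never vanished, s would increase, and from time 1 on the acceleration s³ - s =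
-s(1 - s²) would be at most -λ s(1); such a p must become nonpositive. -/
theorem exists_first_zero {s p : ℝ → ℝ} {κ lam : ℝ} (hκ : 0 < κ) (hlam : 0 < lam)
    (hs : ∀ x, 0 ≤ x → HasDerivAt s (p x) x) (hp : ∀ x, 0 ≤ x → HasDerivAt p (s x ^ 3 - s x) x)
    (hb : ∀ x, 0 ≤ x → s x ^ 2 ≤ 1 - lam) (hs0 : s 0 = 0) (hp0 : p 0 = κ / √2) :
    ∃ K > 0, p K = 0 ∧ ∀ x ∈ Set.Ico 0 K, 0 < p x := by
  have hp0' : 0 < p 0 := by rw [hp0]; positivity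
  have hsc : ContinuousOn s (Set.Ici 0) := fun x hx => (hs x hx).continuousAt.continuousWithinAt
  have hpc : ContinuousOn p (Set.Ici 0) := fun x hx => (hp x hx).continuousAt.continuousWithinAt
  have pos_of_ne : ∀ b, 0 ≤ b → (∀ x ∈ Set.Icc 0 b, p x ≠ 0) → 0 < p b := by
    intro b hb0 hne
    by_contra hle
    obtain ⟨x, hx, hx0⟩ := intermediate_value_Icc' hb0
      (hpc.mono Set.Icc_subset_Ici_self) ⟨not_lt.1 hle, hp0'.le⟩
    exact hne x hx hx0
  have hex : ∃ b, 0 ≤ b ∧ p b = 0 := by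
    by_contra hne
    push Not at hne
    have hpos : ∀ x, 0 ≤ x → 0 < p x := fun x hx => pos_of_ne x hx fun y hy => hne y hy.1
    have hmono : StrictMonoOn s (Set.Ici 0) := by
      refine strictMonoOn_of_deriv_pos (convex_Ici 0) hsc fun x hx => ?_
      rw [interior_Ici] at hx
      rw [(hs x (le_of_lt hx)).deriv]
      exact hpos x (le_of_lt hx)
    have hc : 0 < s 1 := by
      rw [← hs0]; exact hmono Set.self_mem_Ici (Set.mem_Ici.2 zero_le_one) zero_lt_one
    have hanti : AntitoneOn (fun x => p x + s 1 * lam * x) (Set.Ici 1) := by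
      have hd : ∀ x, 1 ≤ x → HasDerivAt (fun x => p x + s 1 * lam * x)
          (s x ^ 3 - s x + s 1 * lam) x := fun x hx => by
        simpa using (hp x (by linarith)).fun_add ((hasDerivAt_id x).const_mul (s 1 * lam))
      refine antitoneOn_of_deriv_nonpos (convex_Ici 1)
        (fun x hx => (hd x hx).continuousAt.continuousWithinAt)
        (fun x hx => (hd x (interior_subset hx)).differentiableAt.differentiableWithinAt)
        fun x hx => ?_
      have hx1 : 1 ≤ x := interior_subset hx
      rw [(hd x hx1).deriv]
      have h1 : s 1 ≤ s x := hmono.monotoneOn (Set.mem_Ici.2 zero_le_one)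
        (Set.mem_Ici.2 (by linarith)) hx1
      have h2 := hb x (by linarith)
      nlinarith [mul_nonneg (hc.le.trans h1) (show 0 ≤ 1 - s x ^ 2 - lam by linarith),
        mul_nonneg (sub_nonneg.2 h1) hlam.le]
    have h1 : 0 < s 1 * lam := by positivity
    -- The time at which the linear upper bound for p, of slope -λ s(1) from time 1, reaches zero.
    have hx : 1 ≤ 1 + p 1 / (s 1 * lam) := by
      have := hpos 1 zero_le_one
      have : 0 < p 1 / (s 1 * lam) := by positivity
      linarith
    have h2 := hanti (Set.mem_Ici.2 le_rfl) (Set.mem_Ici.2 hx) hx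
    have h3 := hpos (1 + p 1 / (s 1 * lam)) (by linarith)
    have h4 : s 1 * lam * (1 + p 1 / (s 1 * lam)) = s 1 * lam + p 1 := by field_simp
    simp only [h4] at h2
    linarith
  obtain ⟨b, hb0, hpb⟩ := hex
  have hcomp : IsCompact {x ∈ Set.Icc 0 b | p x = 0} :=
    isCompact_Icc.of_isClosed_subset
      ((hpc.mono Set.Icc_subset_Ici_self).preimage_isClosed_of_isClosed isClosed_Icc
        (isClosed_singleton (x := (0 : ℝ))))
      (fun x hx => hx.1)
  obtain ⟨K, hK, hleast⟩ := hcomp.exists_isLeast ⟨b, ⟨hb0, le_rfl⟩, hpb⟩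
  refine ⟨K, ?_, hK.2, fun x hx => pos_of_ne x hx.1 fun y hy hy0 => ?_⟩
  · refine lt_of_le_of_ne hK.1.1 fun h => ?_
    have := hK.2
    rw [← h] at this
    exact hp0'.ne' this
  · have := hleast ⟨⟨hy.1, hy.2.trans (hx.2.le.trans hK.1.2)⟩, hy0⟩
    linarith [hy.2, hx.2]

theorem eq_I_of_first_zero {s p : ℝ → ℝ} {κ lam β K : ℝ} (hβ0 : 0 < β) (hβ : β < Real.pi / 2)
    (hlam : lam = Real.cos β) (hκ : κ ^ 2 + lam ^ 2 = 1)
    (hs : ∀ x, 0 ≤ x → HasDerivAt s (p x) x)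
    (he : ∀ x, 0 ≤ x → 2 * p x ^ 2 = κ ^ 2 - 2 * s x ^ 2 + s x ^ 4)
    (hb : ∀ x, 0 ≤ x → s x ^ 2 ≤ 1 - lam) (hs0 : s 0 = 0)
    (hK : 0 < K) (hpK : p K = 0) (hpos : ∀ x ∈ Set.Ico 0 K, 0 < p x) :
    StrictMonoOn s (Set.Icc 0 K) ∧ I β = K := by
  have hlam0 : 0 < lam := by rw [hlam]; exact Real.cos_pos_of_mem_Ioo ⟨by linarith, hβ⟩
  have hmono : StrictMonoOn s (Set.Icc 0 K) := by
    refine strictMonoOn_of_deriv_pos (convex_Icc 0 K)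
      (fun x hx => (hs x hx.1).continuousAt.continuousWithinAt) fun x hx => ?_
    rw [interior_Icc] at hx
    rw [(hs x hx.1.le).deriv]
    exact hpos x ⟨hx.1.le, hx.2⟩
  refine ⟨hmono, ?_⟩
  have h2 : (√2 : ℝ) ^ 2 = 2 := Real.sq_sqrt zero_le_two
  have h20 : (0 : ℝ) < √2 := by positivity
  have hsnn : ∀ x ∈ Set.Icc 0 K, 0 ≤ s x := fun x hx => by
    rw [← hs0]; exact hmono.monotoneOn ⟨le_rfl, hK.le⟩ hx hx.1
  have hlt : ∀ x, 0 ≤ x → (s x / √2) ^ 2 < 1 := fun x hx => by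
    rw [div_pow, h2]; linarith [hb x hx]
  have habs : ∀ x, 0 ≤ x → -1 < s x / √2 ∧ s x / √2 < 1 := fun x hx =>
    abs_lt.1 ((sq_lt_one_iff_abs_lt_one _).1 (hlt x hx))
  -- At a turning point the energy factors as (s² - (1 - λ))(s² - (1 + λ)) = 0, and the bound on s
  -- rules out the larger root.
  have hsK : s K ^ 2 = 1 - lam := by
    have e := he K hK.le
    rw [hpK] at e
    have e2 : (s K ^ 2 - (1 - lam)) * (s K ^ 2 - (1 + lam)) = 0 := by linear_combination -e - hκ
    rcases mul_eq_zero.1 e2 with h | h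
    · linarith
    · have := hb K hK.le; linarith
  set θ : ℝ → ℝ := fun x => 2 * Real.arcsin (s x / √2) with hθ
  have hθd : ∀ x, 0 ≤ x → HasDerivAt θ (2 * (1 / √(1 - (s x / √2) ^ 2) * (p x / √2))) x :=
    fun x hx => (HasDerivAt.comp (h₂ := Real.arcsin) (h := fun x => s x / √2) x
      (Real.hasDerivAt_arcsin (habs x hx).1.ne' (habs x hx).2.ne)
      ((hs x hx).div_const √2)).const_mul 2
  have hθmono : StrictMonoOn θ (Set.Icc 0 K) := by
    intro x hx y hy hxy
    have h := hmono hx hy hxy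
    have : s x / √2 < s y / √2 := by gcongr
    have := Real.strictMonoOn_arcsin ⟨(habs x hx.1).1.le, (habs x hx.1).2.le⟩
      ⟨(habs y hy.1).1.le, (habs y hy.1).2.le⟩ this
    simp only [hθ]; linarith
  have hθ0 : θ 0 = 0 := by simp [hθ, hs0]
  have hθK : θ K = β := by
    have hsin : s K / √2 = Real.sin (β / 2) := by
      have hn : 0 ≤ Real.sin (β / 2) :=
        Real.sin_nonneg_of_nonneg_of_le_pi (by linarith) (by linarith [Real.pi_pos])
      have hn2 : 0 ≤ s K / √2 := div_nonneg (hsnn K ⟨hK.le, le_rfl⟩) h20.le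
      rw [← sq_eq_sq₀ hn2 hn, div_pow, h2, hsK, hlam]
      have h3 := Real.cos_sq (β / 2)
      rw [mul_div_cancel₀ β two_ne_zero] at h3
      have := Real.sin_sq_add_cos_sq (β / 2)
      linarith
    simp only [hθ, hsin]
    rw [Real.arcsin_sin (by linarith) (by linarith)]
    ring
  have hθc : ContinuousOn θ (Set.Icc 0 K) :=
    fun x hx => (hθd x hx.1).continuousAt.continuousWithinAt
  have himg : θ '' Set.Ioo 0 K = Set.Ioo 0 β := by
    apply Set.Subset.antisymm
    · rintro _ ⟨x, hx, rfl⟩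
      refine ⟨?_, ?_⟩
      · rw [← hθ0]
        exact hθmono ⟨le_rfl, hK.le⟩ ⟨hx.1.le, hx.2.le⟩ hx.1
      · rw [← hθK]
        exact hθmono ⟨hx.1.le, hx.2.le⟩ ⟨hK.le, le_rfl⟩ hx.2
    · have := intermediate_value_Ioo hK.le hθc
      rwa [hθ0, hθK] at this
  -- Substituting t = θ(x) on the open interval avoids the singular endpoint; since cos² θ - cos² β
  -- = 2p², the integrand times the Jacobian is identically 1.
  rw [I, intervalIntegral.integral_of_le hβ0.le, MeasureTheory.integral_Ioc_eq_integral_Ioo,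
    ← himg, MeasureTheory.integral_image_eq_integral_abs_deriv_smul measurableSet_Ioo
      (fun x hx => (hθd x hx.1.le).hasDerivWithinAt)
      ((hθmono.mono Set.Ioo_subset_Icc_self).injOn)]
  have hone : ∀ x ∈ Set.Ioo 0 K, |2 * (1 / √(1 - (s x / √2) ^ 2) * (p x / √2))| •
      (Real.cos (θ x / 2) / √(Real.cos (θ x) ^ 2 - Real.cos β ^ 2)) = 1 := by
    intro x hx
    have hx0 : 0 ≤ x := hx.1.le
    have hp : 0 < p x := hpos x ⟨hx0, hx.2⟩
    have hr : 0 < √(1 - (s x / √2) ^ 2) := Real.sqrt_pos.2 (by linarith [hlt x hx0])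
    have c1 : Real.cos (θ x / 2) = √(1 - (s x / √2) ^ 2) := by
      rw [← Real.cos_arcsin]; congr 1; simp only [hθ]; ring
    have c2 : Real.cos (θ x) = 1 - s x ^ 2 := by
      simp only [hθ]
      rw [Real.cos_two_mul, Real.cos_arcsin, Real.sq_sqrt (by linarith [hlt x hx0]), div_pow, h2]
      ring
    have c3 : √(Real.cos (θ x) ^ 2 - Real.cos β ^ 2) = √2 * p x := by
      rw [← hlam, c2, show (1 - s x ^ 2) ^ 2 - lam ^ 2 = (√2 * p x) ^ 2 by
        rw [mul_pow, h2, he x hx0]; linear_combination -hκ]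
      exact Real.sqrt_sq (by positivity)
    rw [c1, c3, abs_of_pos (by positivity), smul_eq_mul]
    generalize √(1 - (s x / √2) ^ 2) = r at hr
    field_simp
    exact h2.symm
  rw [MeasureTheory.setIntegral_congr_fun measurableSet_Ioo hone]
  simp [hK.le]

/-! ### Behaviour along the real axis -/

theorem _root_.AnalyticAt.conj_comp_conj {f : ℂ → ℂ} {z : ℂ} (hf : AnalyticAt ℂ f (conj z)) :
    AnalyticAt ℂ (fun z => conj (f (conj z))) z := by
  rw [Complex.analyticAt_iff_eventually_differentiableAt] at hf ⊢
  have hc : Tendsto (conj : ℂ → ℂ) (𝓝 z) (𝓝 (conj z)) := continuous_conj.continuousAt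
  filter_upwards [hc.eventually hf] with w hw
  simpa [Function.comp_def] using hw.conj_conj

theorem _root_.MeromorphicNFOn.conj_comp_conj {f : ℂ → ℂ} (hf : MeromorphicNFOn f Set.univ) :
    MeromorphicNFOn (fun z => conj (f (conj z))) Set.univ := by
  intro z _
  have hc : Tendsto (conj : ℂ → ℂ) (𝓝 z) (𝓝 (conj z)) := continuous_conj.continuousAt
  rcases hf (Set.mem_univ (conj z)) with h | ⟨n, g, hg, hg0, h⟩
  · left
    filter_upwards [hc.eventually h] with w hw
    simp [hw]
  · right
    refine ⟨n, fun z => conj (g (conj z)), hg.conj_comp_conj, by simpa using hg0, ?_⟩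
    filter_upwards [hc.eventually h] with w hw
    simp [hw]

theorem deriv_conj_comp_conj (f : ℂ → ℂ) :
    deriv (fun z => conj (f (conj z))) = fun z => conj (deriv f (conj z)) :=
  funext fun z => by simpa [Function.comp_def] using congrFun (deriv_conj_conj (f := f)) z

theorem IsGerm.conj_comp_conj {κ : ℝ} {s : ℂ → ℂ} (hs : IsGerm κ s) :
    IsGerm κ (fun z => conj (s (conj z))) where
  analyticAt := AnalyticAt.conj_comp_conj (by simpa using hs.analyticAt)
  map_zero := by simp [hs.map_zero]
  deriv_zero := by simp [deriv_conj_comp_conj, hs.deriv_zero]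
  ode := by
    have hc : Tendsto (conj : ℂ → ℂ) (𝓝 0) (𝓝 0) := by
      simpa using (continuous_conj : Continuous (conj : ℂ → ℂ)).continuousAt (x := 0) |>.tendsto
    filter_upwards [hc.eventually hs.ode] with z hz
    rw [deriv_conj_comp_conj, deriv_conj_comp_conj]
    simp [hz]

theorem IsGerm.neg_comp_neg {κ : ℝ} {s : ℂ → ℂ} (hs : IsGerm κ s) :
    IsGerm κ (fun z => -s (-z)) := by
  have d : ∀ g : ℂ → ℂ, deriv (fun z => g (-z)) = fun z => -deriv g (-z) := fun g =>
    funext fun z => deriv_comp_neg g z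
  have d1 : deriv (fun z => -s (-z)) = fun z => deriv s (-z) := by
    funext z
    rw [deriv.fun_neg, d, neg_neg]
  refine ⟨?_, by simp [hs.map_zero], by rw [d1]; simpa using hs.deriv_zero, ?_⟩
  · have : AnalyticAt ℂ (fun z : ℂ => -z) 0 := by fun_prop
    exact (AnalyticAt.fun_comp (f := fun z : ℂ => -z) (by simpa using hs.analyticAt) this).neg
  · have hc : Tendsto (fun z : ℂ => -z) (𝓝 0) (𝓝 0) := by
      simpa using (continuous_neg (G := ℂ)).continuousAt (x := 0) |>.tendsto
    filter_upwards [hc.eventually hs.ode] with z hz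
    rw [d1, d]
    simp only [hz]
    ring

/-- `S` is the meromorphic continuation, in normal form, of the solution germ. -/
structure IsSn (κ : ℝ) (S : ℂ → ℂ) : Prop where
  isGerm : IsGerm κ S
  nf : MeromorphicNFOn S Set.univ

namespace IsSn

variable {κ : ℝ} {S : ℂ → ℂ}

theorem meromorphicAt (hS : IsSn κ S) (z : ℂ) : MeromorphicAt S z :=
  (hS.nf (Set.mem_univ z)).meromorphicAt

theorem ode (hS : IsSn κ S) {z : ℂ} (hz : AnalyticAt ℂ S z) :
    ∀ᶠ w in 𝓝 z, deriv (deriv S) w = S w ^ 3 - S w := by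
  have h := eventuallyEq_nhdsNE_of_eventuallyEq (f := deriv (deriv S))
    (g := fun w => S w ^ 3 - S w) (U := Set.univ) (y := z)
    (fun w _ => (hS.meromorphicAt w).deriv.deriv)
    (fun w _ => ((hS.meromorphicAt w).fun_pow 3).fun_sub (hS.meromorphicAt w))
    isPreconnected_univ (Set.mem_univ 0) (Set.mem_univ z)
    (hS.isGerm.ode.filter_mono nhdsWithin_le_nhds)
  exact (hz.deriv.deriv.continuousAt.eventuallyEq_nhds_iff_eventuallyEq_nhdsNE
    (by have := hz.continuousAt; fun_prop)).1 h

theorem energy (hS : IsSn κ S) {z : ℂ} (hz : AnalyticAt ℂ S z) :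
    2 * deriv S z ^ 2 = κ ^ 2 - 2 * S z ^ 2 + S z ^ 4 := by
  have h := eventuallyEq_nhdsNE_of_eventuallyEq (f := fun w => 2 * deriv S w ^ 2)
    (g := fun w => κ ^ 2 - 2 * S w ^ 2 + S w ^ 4) (U := Set.univ) (y := z)
    (fun w _ => (MeromorphicAt.const _ _).fun_mul ((hS.meromorphicAt w).deriv.fun_pow 2))
    (fun w _ => ((MeromorphicAt.const _ _).fun_sub ((MeromorphicAt.const _ _).fun_mul
      ((hS.meromorphicAt w).fun_pow 2))).fun_add ((hS.meromorphicAt w).fun_pow 4))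
    isPreconnected_univ (Set.mem_univ 0) (Set.mem_univ z)
    (hS.isGerm.energy.filter_mono nhdsWithin_le_nhds)
  have h1 := hz.continuousAt
  have h2 := hz.deriv.continuousAt
  exact ((ContinuousAt.eventuallyEq_nhds_iff_eventuallyEq_nhdsNE (by fun_prop)
    (by fun_prop)).1 h).eq_of_nhds

theorem conj_apply (hS : IsSn κ S) (z : ℂ) : conj (S (conj z)) = S z :=
  congrFun (eq_of_meromorphicNFOn hS.nf.conj_comp_conj hS.nf
    ((hS.isGerm.conj_comp_conj.unique hS.isGerm).filter_mono nhdsWithin_le_nhds)) z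

theorem ofReal_re (hS : IsSn κ S) (x : ℝ) : ((S x).re : ℂ) = S x := by
  have := hS.conj_apply x
  rw [conj_ofReal] at this
  exact conj_eq_iff_re.1 this

theorem deriv_ofReal_re (hS : IsSn κ S) (x : ℝ) : ((deriv S x).re : ℂ) = deriv S x := by
  have h := congrFun (deriv_conj_comp_conj S) x
  rw [conj_ofReal, show (fun z => conj (S (conj z))) = S from funext hS.conj_apply] at h
  exact conj_eq_iff_re.1 h.symm

theorem energy_re (hS : IsSn κ S) {x : ℝ} (hx : AnalyticAt ℂ S x) :
    2 * (deriv S x).re ^ 2 = κ ^ 2 - 2 * (S x).re ^ 2 + (S x).re ^ 4 := by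
  have := hS.energy hx
  rw [← hS.ofReal_re, ← hS.deriv_ofReal_re] at this
  exact_mod_cast this

/-- At a pole the norm tends to infinity, and in normal form nonnegative order means analytic. -/
theorem analyticAt_of_frequently_bounded (hS : IsSn κ S) {z : ℂ} {C : ℝ}
    (h : ∃ᶠ w in 𝓝[≠] z, ‖S w‖ ≤ C) : AnalyticAt ℂ S z := by
  rw [← (hS.nf (Set.mem_univ z)).meromorphicOrderAt_nonneg_iff_analyticAt]
  by_contra hneg
  have := tendsto_norm_atTop_iff_cobounded.2
    (tendsto_cobounded_of_meromorphicOrderAt_neg (not_le.1 hneg))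
  exact h ((this.eventually_gt_atTop C).mono fun w hw => not_le.2 hw)

/-- A continuity argument on [0, x]. For real values, 2 s'² ≥ 0 forbids s² from lying strictly
between 1 - λ and 1 + λ, so s² starts below this gap and cannot jump across it; boundedness excludes
poles at limit points. -/
theorem real_axis (hS : IsSn κ S) {lam : ℝ} (hlam : 0 < lam) (hlam1 : lam ≤ 1)
    (hκ : κ ^ 2 + lam ^ 2 = 1) {x : ℝ} (hx : 0 ≤ x) :
    AnalyticAt ℂ S x ∧ (S x).re ^ 2 ≤ 1 - lam := by
  set A : Set ℝ := {x | AnalyticAt ℂ S x ∧ (S x).re ^ 2 ≤ 1 - lam} with hA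
  suffices Set.Icc 0 x ⊆ A from this ⟨hx, le_rfl⟩
  have hcl : IsClosed A := by
    rw [isClosed_iff_frequently]
    intro y hy
    by_contra hyA
    have hy' : ∃ᶠ w in 𝓝[≠] y, w ∈ A := by
      rw [frequently_nhdsWithin_iff]
      refine hy.mono fun w hw => ⟨hw, fun h => hyA ?_⟩
      rwa [← Set.mem_singleton_iff.1 h]
    have ht : Tendsto (fun w : ℝ => (w : ℂ)) (𝓝[≠] y) (𝓝[≠] (y : ℂ)) := by
      refine tendsto_nhdsWithin_iff.2 ⟨(continuous_ofReal.tendsto y).mono_left nhdsWithin_le_nhds,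
        ?_⟩
      filter_upwards [self_mem_nhdsWithin] with w hw
      simpa using hw
    have han : AnalyticAt ℂ S y := by
      refine hS.analyticAt_of_frequently_bounded (C := 1) (ht.frequently (hy'.mono fun w hw => ?_))
      rw [← hS.ofReal_re, norm_real, Real.norm_eq_abs, ← sq_le_one_iff_abs_le_one]
      linarith [hw.2]
    have hc : ContinuousAt (fun w : ℝ => (S w).re ^ 2) y := by
      have : ContinuousAt (fun w : ℝ => S w) y :=
        ContinuousAt.comp (f := fun w : ℝ => (w : ℂ)) han.continuousAt
          continuous_ofReal.continuousAt
      exact (continuous_re.continuousAt.comp this).pow 2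
    refine hyA ⟨han, ?_⟩
    by_contra hlt
    have := continuousAt_const.eventually_lt hc (not_le.1 hlt)
    exact hy (this.mono fun w hw h => absurd h.2 (not_le.2 hw))
  refine (hcl.inter isClosed_Icc).Icc_subset_of_forall_mem_nhdsWithin ?_ fun y hy => ?_
  · simp only [hA, Set.mem_ofPred_eq, ofReal_zero, hS.isGerm.map_zero, zero_re]
    exact ⟨hS.isGerm.analyticAt, by nlinarith⟩
  · apply mem_nhdsWithin_of_mem_nhds
    have hc : ContinuousAt (fun w : ℝ => (S w).re ^ 2) y := by
      have : ContinuousAt (fun w : ℝ => S w) y :=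
        ContinuousAt.comp (f := fun w : ℝ => (w : ℂ)) hy.1.1.continuousAt
          continuous_ofReal.continuousAt
      exact (continuous_re.continuousAt.comp this).pow 2
    have h1 := hc.eventually_lt (continuousAt_const (y := 1 + lam)) (by linarith [hy.1.2])
    have h2 := (continuous_ofReal.tendsto y).eventually hy.1.1.eventually_analyticAt
    filter_upwards [h1, h2] with w hw1 hw2
    refine ⟨hw2, ?_⟩
    have he := hS.energy_re hw2
    by_contra hlt
    have : (1 - lam - (S w).re ^ 2) * (1 + lam - (S w).re ^ 2) < 0 :=
      mul_neg_of_neg_of_pos (by linarith) (by linarith)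
    nlinarith [sq_nonneg (deriv S w).re]

/-- The first turning point on the positive real axis. -/
theorem exists_turning_point (hS : IsSn κ S) {lam β : ℝ} (hκ0 : 0 < κ) (hβ0 : 0 < β)
    (hβ : β < Real.pi / 2) (hlam : lam = Real.cos β) (hκ : κ ^ 2 + lam ^ 2 = 1) :
    0 < I β ∧ (∀ x ∈ Set.Icc 0 (I β), AnalyticAt ℂ S x) ∧ deriv S (I β) = 0 ∧
      (∀ x ∈ Set.Ioc 0 (I β), 0 < (S x).re) ∧ (∀ x ∈ Set.Ico 0 (I β), 0 < (deriv S x).re) := by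
  have hlam0 : 0 < lam := by rw [hlam]; exact Real.cos_pos_of_mem_Ioo ⟨by linarith, hβ⟩
  have hlam1 : lam ≤ 1 := by rw [hlam]; exact Real.cos_le_one β
  have hax := fun (x : ℝ) (hx : 0 ≤ x) => hS.real_axis hlam0 hlam1 hκ hx
  have hs : ∀ x : ℝ, 0 ≤ x → HasDerivAt (fun x : ℝ => (S x).re) (deriv S x).re x :=
    fun x hx => (hax x hx).1.differentiableAt.hasDerivAt.real_of_complex
  have hp : ∀ x : ℝ, 0 ≤ x → HasDerivAt (fun x : ℝ => (deriv S x).re)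
      ((S x).re ^ 3 - (S x).re) x := fun x hx => by
    have h := (hax x hx).1.deriv.differentiableAt.hasDerivAt.real_of_complex
    rw [(hS.ode (hax x hx).1).self_of_nhds, ← hS.ofReal_re] at h
    convert h using 1
    norm_cast
  have hs0 : (S (0 : ℝ)).re = 0 := by simp [hS.isGerm.map_zero]
  have hp0 : (deriv S (0 : ℝ)).re = κ / √2 := by
    rw [ofReal_zero, hS.isGerm.deriv_zero, ← ofReal_div, Complex.ofReal_re]
  obtain ⟨K, hK, hpK, hpos⟩ := exists_first_zero hκ0 hlam0 hs hp (fun x hx => (hax x hx).2) hs0 hp0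
  obtain ⟨hmono, hI⟩ := eq_I_of_first_zero hβ0 hβ hlam hκ hs
    (fun x hx => hS.energy_re (hax x hx).1) (fun x hx => (hax x hx).2) hs0 hK hpK hpos
  rw [hI]
  refine ⟨hK, fun x hx => (hax x hx.1).1, ?_, fun x hx => ?_, hpos⟩
  · rw [← hS.deriv_ofReal_re, hpK, ofReal_zero]
  · rw [← hs0]
    exact hmono ⟨le_rfl, hK.le⟩ ⟨hx.1.le, hx.2⟩ hx.1

/-- The equation is invariant under z ↦ 2K - z, and the vanishing slope makes the initial data at K
agree. -/
theorem reflection (hS : IsSn κ S) {K : ℂ} (hK : AnalyticAt ℂ S K) (hd : deriv S K = 0) :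
    (fun z => S (2 * K - z)) =ᶠ[𝓝 K] S := by
  have e : 2 * K - K = K := by ring
  have d : ∀ g : ℂ → ℂ, deriv (fun z => g (2 * K - z)) = fun z => -deriv g (2 * K - z) := fun g =>
    funext fun z => deriv_comp_const_sub g (2 * K) z
  have hg : AnalyticAt ℂ (fun z => 2 * K - z) K := by fun_prop
  have ht : Tendsto (fun z => 2 * K - z) (𝓝 K) (𝓝 K) := by
    simpa [e] using hg.continuousAt.tendsto
  refine ode_unique (AnalyticAt.fun_comp (f := fun z => 2 * K - z) (by simpa [e] using hK) hg) hK
    (by simp [e]) (by rw [d]; simp [e, hd]) ?_ (hS.ode hK)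
  filter_upwards [ht.eventually (hS.ode hK)] with z hz
  rw [d, deriv.fun_neg, d, neg_neg]
  exact hz

end IsSn

theorem exists_isSn {κ lam : ℝ} (hκ : κ ^ 2 + lam ^ 2 = 1) (hκ0 : κ ≠ 0) (hlam : lam ≠ 0) :
    ∃ S, IsSn κ S := by
  obtain ⟨S, h1, h2⟩ := exists_isGerm_meromorphicNFOn hκ hκ0 hlam
  exact ⟨S, h1, h2⟩

/-! ### Period lattices -/

/-- Subtracting the nearest multiple of 2K leaves a period r e with |r| ≤ K; evenness gives d(|r| e)
= d(0), so r = 0. -/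
theorem exists_int_of_periodic_real_mul {d : ℂ → ℂ} {e : ℂ} {K : ℝ} (hK : 0 < K)
    (heven : ∀ z, d (-z) = d z) (hper : Function.Periodic d (2 * K * e))
    (hne : ∀ x ∈ Set.Ioc 0 K, d (x * e) ≠ d 0) {x : ℝ} (hx : Function.Periodic d (x * e)) :
    ∃ m : ℤ, x = 2 * K * m := by
  set m : ℤ := round (x / (2 * K)) with hm
  refine ⟨m, ?_⟩
  set r : ℝ := x - 2 * K * m with hr
  have h2K : 0 < 2 * K := by positivity
  have hrK : |r| ≤ K := by
    have h := abs_sub_round (x / (2 * K))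
    have e1 : r = 2 * K * (x / (2 * K) - m) := by rw [hr]; field_simp
    rw [e1, abs_mul, abs_of_pos h2K]
    nlinarith
  have hpr : Function.Periodic d (r * e) := by
    have := hx.sub_period (hper.int_mul m)
    rwa [show (x : ℂ) * e - m * (2 * K * e) = r * e by rw [hr]; push_cast; ring] at this
  have h0 : d (r * e) = d 0 := by simpa using hpr 0
  have habs : d (|r| * e) = d 0 := by
    rcases abs_choice r with h | h
    · rw [h, h0]
    · rw [h, ofReal_neg, neg_mul, heven, h0]
  have : r = 0 := by
    by_contra hr0
    exact hne |r| ⟨abs_pos.2 hr0, hrK⟩ habs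
  rw [hr] at this
  linarith

/-- Conjugation makes ω ± conj ω periods along the axes, so ω = mK + niK'. Modulo the known periods
only K, iK' and K + iK' remain to be excluded, according to the parities of m and n. -/
theorem isHalfPeriods_of {d : ℂ → ℂ} {K K' : ℝ} (hK : 0 < K) (hK' : 0 < K')
    (heven : ∀ z, d (-z) = d z) (hconj : ∀ z, d (conj z) = conj (d z))
    (hper : Function.Periodic d (2 * K)) (hper' : Function.Periodic d (2 * K' * Complex.I))
    (hne : ∀ x ∈ Set.Ioc 0 K, d x ≠ d 0) (hne' : ∀ x ∈ Set.Ioc 0 K', d (x * Complex.I) ≠ d 0)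
    (hmix : d (K' * Complex.I) ≠ d K) : IsHalfPeriods d K K' := by
  refine ⟨hK, hK', fun ω => ⟨fun hω => ?_, ?_⟩⟩
  · have hω' : Function.Periodic d (conj ω) := fun z => by
      have := congrArg conj (hω (conj z))
      rwa [← hconj, ← hconj, map_add, conj_conj] at this
    have hre : Function.Periodic d ((2 * ω.re : ℝ) * 1) := by
      have := hω.add_period hω'
      rwa [add_conj, ← mul_one (((2 * ω.re : ℝ) : ℂ))] at this
    have him : Function.Periodic d ((2 * ω.im : ℝ) * Complex.I) := by
      have := hω.sub_period hω'
      rwa [sub_conj] at this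
    obtain ⟨m, hm⟩ := exists_int_of_periodic_real_mul hK heven (by simpa using hper)
      (by simpa using hne) hre
    obtain ⟨n, hn⟩ := exists_int_of_periodic_real_mul hK' heven hper' hne' him
    have hω0 : ω = m * K + n * (K' * Complex.I) := by
      have h1 : ω.re = m * K := by linarith
      have h2 : ω.im = n * K' := by linarith
      rw [← re_add_im ω, h1, h2]; push_cast; ring
    have red : ∀ a b : ℤ, Function.Periodic d ((m - 2 * a : ℤ) * K +
        (n - 2 * b : ℤ) * (K' * Complex.I)) := fun a b => by
      have := (hω.sub_period (hper.int_mul a)).sub_period (hper'.int_mul b)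
      rwa [show ω - a * (2 * K) - b * (2 * K' * Complex.I) = (m - 2 * a : ℤ) * K +
        (n - 2 * b : ℤ) * (K' * Complex.I) by rw [hω0]; push_cast; ring] at this
    rcases Int.even_or_odd' m with ⟨a, ha | ha⟩ <;> rcases Int.even_or_odd' n with ⟨b, hb | hb⟩
    · exact ⟨a, b, by rw [hω0, ha, hb]; push_cast; ring⟩
    · have h := red a b 0
      rw [ha, hb] at h
      simp only [sub_self, Int.cast_zero, zero_mul, zero_add, add_sub_cancel_left, Int.cast_one,
        one_mul] at h
      exact absurd h (hne' K' ⟨hK', le_rfl⟩)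
    · have h := red a b 0
      rw [ha, hb] at h
      simp only [sub_self, Int.cast_zero, zero_mul, add_zero, zero_add, add_sub_cancel_left,
        Int.cast_one, one_mul] at h
      exact absurd h (hne K ⟨hK, le_rfl⟩)
    -- If K + iK' were a period, evaluation at -K and evenness would give d(iK') = d(K).
    · have h := red a b (-K)
      rw [ha, hb] at h
      simp only [add_sub_cancel_left, Int.cast_one, one_mul, neg_add_cancel_left, heven] at h
      exact absurd h hmix
  · rintro ⟨m, n, rfl⟩
    have := (hper.int_mul m).add_period (hper'.int_mul n)
    rwa [mul_right_comm 2 (K' : ℂ)] at this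

theorem IsHalfPeriods.le {d : ℂ → ℂ} {K K' L L' : ℝ} (h : IsHalfPeriods d K K')
    (h' : IsHalfPeriods d L L') : K ≤ L ∧ K' ≤ L' := by
  have aux : ∀ {a b : ℝ} {m : ℤ}, 0 < a → 0 < b → a = m * b → b ≤ a := by
    intro a b m ha hb hab
    have hm : (0 : ℝ) < m := pos_of_mul_pos_left (hab ▸ ha) hb.le
    have hm1 : (1 : ℝ) ≤ m := by exact_mod_cast (show 0 < m by exact_mod_cast hm)
    rw [hab]; nlinarith
  constructor
  · obtain ⟨m, n, hmn⟩ := (h.periodic_iff (2 * L)).1 ((h'.periodic_iff _).2 ⟨1, 0, by simp⟩)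
    have := congrArg re hmn
    simp at this
    exact aux (m := m) h'.pos h.pos (by linarith)
  · obtain ⟨m, n, hmn⟩ := (h.periodic_iff (2 * Complex.I * L')).1
      ((h'.periodic_iff _).2 ⟨0, 1, by simp⟩)
    have := congrArg im hmn
    simp at this
    exact aux (m := n) h'.pos' h.pos' (by linarith)

theorem IsHalfPeriods.unique {d : ℂ → ℂ} {K K' L L' : ℝ} (h : IsHalfPeriods d K K')
    (h' : IsHalfPeriods d L L') : K = L ∧ K' = L' :=
  ⟨le_antisymm (h.le h').1 (h'.le h).1, le_antisymm (h.le h').2 (h'.le h).2⟩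

/-! ### The function `d` -/

theorem _root_.MeromorphicNFOn.comp_analytic {f g : ℂ → ℂ} (hf : MeromorphicNFOn f Set.univ)
    (hg : ∀ z, AnalyticAt ℂ g z) : MeromorphicNFOn (fun z => f (g z)) Set.univ :=
  fun z _ => (hf (Set.mem_univ (g z))).comp_analyticAt (hg z)

namespace IsD

variable {κ : ℝ} {d S : ℂ → ℂ}

theorem eventuallyEq (hd : IsD κ d) (hS : IsSn κ S) : d =ᶠ[𝓝 0] fun z => 1 - S z ^ 2 :=
  (exists_phi_psi_iff hS.isGerm).1 hd.eq_cos_psi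

theorem eventuallyEq_of_analyticAt (hd : IsD κ d) (hS : IsSn κ S) {z : ℂ}
    (hz : AnalyticAt ℂ S z) : d =ᶠ[𝓝 z] fun z => 1 - S z ^ 2 :=
  ((hd.meromorphic (Set.mem_univ z)).eventuallyEq_nhdsNE_iff_eventuallyEq_nhds
    (AnalyticAt.meromorphicNFAt (by fun_prop))).1 <|
    eventuallyEq_nhdsNE_of_eventuallyEq hd.meromorphic.meromorphicOn
      (fun w _ => (MeromorphicAt.const _ _).fun_sub ((hS.meromorphicAt w).fun_pow 2))
      isPreconnected_univ (Set.mem_univ 0) (Set.mem_univ z)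
      ((hd.eventuallyEq hS).filter_mono nhdsWithin_le_nhds)

theorem unique {d' : ℂ → ℂ} (hS : IsSn κ S) (hd : IsD κ d) (hd' : IsD κ d') : d = d' :=
  eq_of_meromorphicNFOn hd.meromorphic hd'.meromorphic
    (((hd.eventuallyEq hS).trans (hd'.eventuallyEq hS).symm).filter_mono nhdsWithin_le_nhds)

theorem exists_of_isSn (hS : IsSn κ S) : ∃ d, IsD κ d := by
  have hm : MeromorphicOn (fun z => 1 - S z ^ 2) Set.univ :=
    fun w _ => (MeromorphicAt.const _ _).fun_sub ((hS.meromorphicAt w).fun_pow 2)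
  have ha := hS.isGerm.analyticAt
  exact ⟨_, meromorphicNFOn_toMeromorphicNFOn _ _, (exists_phi_psi_iff hS.isGerm).2
    (toMeromorphicNFOn_eventuallyEq hm (Set.mem_univ 0) (by fun_prop))⟩

theorem apply_neg (hd : IsD κ d) (hS : IsSn κ S) (z : ℂ) : d (-z) = d z := by
  refine congrFun (eq_of_meromorphicNFOn (hd.meromorphic.comp_analytic fun z => by fun_prop)
    hd.meromorphic (x := 0) (EventuallyEq.filter_mono ?_ nhdsWithin_le_nhds)) z
  have hc : Tendsto (fun z : ℂ => -z) (𝓝 0) (𝓝 0) := by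
    simpa using (continuous_neg (G := ℂ)).continuousAt (x := 0) |>.tendsto
  filter_upwards [hd.eventuallyEq hS, hc.eventually (hd.eventuallyEq hS),
    hS.isGerm.neg_comp_neg.unique hS.isGerm] with w h1 h2 h3
  rw [h1, h2, ← h3, neg_sq]

theorem apply_conj (hd : IsD κ d) (hS : IsSn κ S) (z : ℂ) : d (conj z) = conj (d z) := by
  have h := congrFun (eq_of_meromorphicNFOn hd.meromorphic.conj_comp_conj
    hd.meromorphic (x := 0) (EventuallyEq.filter_mono ?_ nhdsWithin_le_nhds)) z
  · rw [← h, conj_conj]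
  have hc : Tendsto (conj : ℂ → ℂ) (𝓝 0) (𝓝 0) := by
    simpa using (continuous_conj : Continuous (conj : ℂ → ℂ)).continuousAt (x := 0) |>.tendsto
  filter_upwards [hd.eventuallyEq hS, hc.eventually (hd.eventuallyEq hS)] with w h1 h2
  rw [h1, h2, map_sub, map_pow, hS.conj_apply, map_one]

theorem apply_zero (hd : IsD κ d) (hS : IsSn κ S) : d 0 = 1 := by
  rw [(hd.eventuallyEq hS).eq_of_nhds, hS.isGerm.map_zero]; ring

/-- The reflections in K and in `0` compose to the translation by 2K. -/
theorem periodic_of_deriv_eq_zero (hd : IsD κ d) (hS : IsSn κ S) {K : ℂ}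
    (hK : AnalyticAt ℂ S K) (h0 : deriv S K = 0) : Function.Periodic d (2 * K) := by
  have href : (fun z => d (2 * K - z)) = d := by
    refine eq_of_meromorphicNFOn (hd.meromorphic.comp_analytic fun z => by fun_prop)
      hd.meromorphic (x := K) (EventuallyEq.filter_mono ?_ nhdsWithin_le_nhds)
    have hc : Tendsto (fun z => 2 * K - z) (𝓝 K) (𝓝 K) := by
      have : ContinuousAt (fun z => 2 * K - z) K := by fun_prop
      have h := this.tendsto
      rwa [show 2 * K - K = K by ring] at h
    filter_upwards [hd.eventuallyEq_of_analyticAt hS hK,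
      hc.eventually (hd.eventuallyEq_of_analyticAt hS hK), hS.reflection hK h0] with w h1 h2 h3
    rw [h1, h2, h3]
  intro z
  rw [← hd.apply_neg hS z, ← congrFun href (-z)]
  congr 1; ring

theorem rot_mul_sqrt_two_mul_I (u : ℂ) : rot * (u * (√2 * Complex.I)) = u := by
  rw [mul_left_comm, rot_mul, mul_one]

/-- On the line through `0` and `i`, `d` is given by the complementary modulus. -/
theorem eventuallyEq_isogeny {lam : ℝ} {T : ℂ → ℂ} (hκ : κ ^ 2 + lam ^ 2 = 1) (hlam : lam ≠ 0)
    (hd : IsD κ d) (hS : IsSn κ S) (hT : IsSn lam T) (z : ℂ) :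
    (fun u => d (u * (√2 * Complex.I))) =ᶠ[𝓝[≠] z]
      fun u => 1 + κ ^ 2 * (T u ^ 2 / deriv T u ^ 2) := by
  refine eventuallyEq_nhdsNE_of_eventuallyEq (U := Set.univ) (x := 0)
    (hd.meromorphic.comp_analytic fun z => by fun_prop).meromorphicOn
    (fun w _ => ?_) isPreconnected_univ (Set.mem_univ 0) (Set.mem_univ z)
    (EventuallyEq.filter_mono ?_ nhdsWithin_le_nhds)
  · exact (MeromorphicAt.const _ _).fun_add ((MeromorphicAt.const _ _).fun_mul
      (((hT.meromorphicAt w).fun_pow 2).fun_div ((hT.meromorphicAt w).deriv.fun_pow 2)))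
  · have hc : Tendsto (fun u : ℂ => u * (√2 * Complex.I)) (𝓝 0) (𝓝 0) := by
      have : ContinuousAt (fun u : ℂ => u * (√2 * Complex.I)) 0 := by fun_prop
      simpa using this.tendsto
    filter_upwards [hc.eventually (hd.eventuallyEq hS),
      hc.eventually (hS.isGerm.unique (hT.isGerm.isogeny hκ hlam))] with u h1 h2
    rw [h1, h2, rot_mul_sqrt_two_mul_I, mul_pow, mul_pow, I_sq, div_pow]
    ring

theorem apply_isogeny {lam : ℝ} {T : ℂ → ℂ} (hκ : κ ^ 2 + lam ^ 2 = 1) (hlam : lam ≠ 0)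
    (hd : IsD κ d) (hS : IsSn κ S) (hT : IsSn lam T) {z : ℂ} (hz : AnalyticAt ℂ T z)
    (h0 : deriv T z ≠ 0) :
    d (z * (√2 * Complex.I)) = 1 + κ ^ 2 * (T z ^ 2 / deriv T z ^ 2) := by
  have hz' := hz.deriv
  have ha : AnalyticAt ℂ (fun u => 1 + κ ^ 2 * (T u ^ 2 / deriv T u ^ 2)) z :=
    analyticAt_const.add (analyticAt_const.mul
      ((hz.fun_pow 2).fun_div (hz'.fun_pow 2) (pow_ne_zero 2 h0)))
  exact (((hd.meromorphic.comp_analytic (g := fun u => u * (√2 * Complex.I))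
    fun z => by fun_prop) (Set.mem_univ z)).eventuallyEq_nhdsNE_iff_eventuallyEq_nhds
      ha.meromorphicNFAt).1 (hd.eventuallyEq_isogeny hκ hlam hS hT z) |>.eq_of_nhds

/-- The value `0` is the normal-form convention at a pole. Were the function analytic at z, then (d
- 1) T'² = κ² T² would extend to z by continuity and force T z = 0. -/
theorem apply_isogeny_eq_zero {lam : ℝ} {T : ℂ → ℂ} (hκ : κ ^ 2 + lam ^ 2 = 1) (hκ0 : κ ≠ 0)
    (hlam : lam ≠ 0) (hd : IsD κ d) (hS : IsSn κ S) (hT : IsSn lam T) {z : ℂ}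
    (hz : AnalyticAt ℂ T z) (h0 : deriv T z = 0) (hTz : T z ≠ 0) :
    d (z * (√2 * Complex.I)) = 0 := by
  have hnf := (hd.meromorphic.comp_analytic (g := fun u => u * (√2 * Complex.I))
    fun z => by fun_prop) (Set.mem_univ z)
  rcases meromorphicNFAt_iff_analyticAt_or.1 hnf with ha | ⟨-, -, h⟩
  · exfalso
    have hne : ∀ᶠ u in 𝓝[≠] z, deriv T u ≠ 0 := by
      rcases hz.deriv.eventually_eq_zero_or_eventually_ne_zero with h | h
      -- If T' vanished identically near z, the equation would give T² = 1 and the energy λ² = 1,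
      -- hence κ = 0.
      · exfalso
        have h1 := (EventuallyEq.deriv (f := fun _ => (0 : ℂ)) (f₁ := deriv T) h).eq_of_nhds
        have h2 := hT.energy hz
        have h3 := (hT.ode hz).self_of_nhds
        have hκ' : (κ : ℂ) ^ 2 + lam ^ 2 = 1 := by exact_mod_cast hκ
        simp only [deriv_const] at h1
        rw [h1] at h3
        rw [h0] at h2
        have h4 : T z ^ 2 = 1 := by
          apply mul_left_cancel₀ hTz
          linear_combination -h3
        apply hκ0
        have : (κ : ℂ) ^ 2 = 0 := by
          linear_combination hκ' + h2 + (T z ^ 2 - 1) * h4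
        exact_mod_cast pow_eq_zero_iff (two_ne_zero) |>.1 this
      · exact h
    have hz1 := hz.continuousAt
    have hz2 := hz.deriv.continuousAt
    have hz3 : ContinuousAt (fun u => d (u * (√2 * Complex.I))) z := ha.continuousAt
    have h := (ContinuousAt.eventuallyEq_nhds_iff_eventuallyEq_nhdsNE
      (f := fun u => (d (u * (√2 * Complex.I)) - 1) * deriv T u ^ 2)
      (g := fun u => κ ^ 2 * T u ^ 2) (x := z)
      ((hz3.sub continuousAt_const).mul (hz2.pow 2)) (by fun_prop)).1 (by
        filter_upwards [hne, hd.eventuallyEq_isogeny hκ hlam hS hT z] with u h1 h2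
        rw [h2]; field_simp; ring)
    have h := h.eq_of_nhds
    rw [h0] at h
    have : (κ : ℂ) ^ 2 * T z ^ 2 ≠ 0 :=
      mul_ne_zero (pow_ne_zero 2 (by exact_mod_cast hκ0)) (pow_ne_zero 2 hTz)
    exact this (by rw [← h]; ring)
  · exact h

/-- Since T² = 1 - d' and 2 T'² = d'² - κ², d(√2 i u) is a rational function of d'(u) and inherits
its periods. -/
theorem periodic_isogeny {lam : ℝ} {T d' : ℂ → ℂ} (hκ : κ ^ 2 + lam ^ 2 = 1) (hlam : lam ≠ 0)
    (hd : IsD κ d) (hS : IsSn κ S) (hT : IsSn lam T) (hd' : IsD lam d') {K : ℂ}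
    (hK : Function.Periodic d' K) : Function.Periodic d (K * (√2 * Complex.I)) := by
  have hκ' : (κ : ℂ) ^ 2 + lam ^ 2 = 1 := by exact_mod_cast hκ
  have key : ∀ z, (fun u => d (u * (√2 * Complex.I))) =ᶠ[𝓝[≠] z]
      fun u => 1 + κ ^ 2 * (2 * (1 - d' u) / (d' u ^ 2 - κ ^ 2)) := by
    intro z
    have h1 : (fun u => d (u * (√2 * Complex.I))) =ᶠ[𝓝[≠] (0 : ℂ)]
        fun u => 1 + κ ^ 2 * (2 * (1 - d' u) / (d' u ^ 2 - κ ^ 2)) := by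
      filter_upwards [hd.eventuallyEq_isogeny hκ hlam hS hT 0,
        (hd'.eventuallyEq hT).filter_mono nhdsWithin_le_nhds,
        hT.isGerm.energy.filter_mono nhdsWithin_le_nhds] with u h2 h3 h4
      rw [h2, h3, show (1 - T u ^ 2) ^ 2 - (κ : ℂ) ^ 2 = 2 * deriv T u ^ 2 by
        rw [h4]; linear_combination -hκ', show 2 * (1 - (1 - T u ^ 2)) = 2 * T u ^ 2 by ring,
        mul_div_mul_left _ _ two_ne_zero]
    have m' := fun w => (hd'.meromorphic (Set.mem_univ w)).meromorphicAt
    exact eventuallyEq_nhdsNE_of_eventuallyEq (U := Set.univ)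
      (hd.meromorphic.comp_analytic fun z => by fun_prop).meromorphicOn
      (fun w _ => (MeromorphicAt.const _ _).fun_add ((MeromorphicAt.const _ _).fun_mul
        (((MeromorphicAt.const _ _).fun_mul ((MeromorphicAt.const _ _).fun_sub (m' w))).fun_div
          (((m' w).fun_pow 2).fun_sub (MeromorphicAt.const _ _)))))
      isPreconnected_univ (Set.mem_univ 0) (Set.mem_univ z) h1
  have hshift : (fun u => d ((u + K) * (√2 * Complex.I))) =
      fun u => d (u * (√2 * Complex.I)) := by
    refine eq_of_meromorphicNFOn (x := 0) (hd.meromorphic.comp_analytic fun z => by fun_prop)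
      (hd.meromorphic.comp_analytic fun z => by fun_prop) ?_
    have ht : Tendsto (fun u : ℂ => u + K) (𝓝[≠] 0) (𝓝[≠] (0 + K)) := by
      refine tendsto_nhdsWithin_iff.2 ⟨?_, ?_⟩
      · have : ContinuousAt (fun u : ℂ => u + K) 0 := by fun_prop
        exact this.tendsto.mono_left nhdsWithin_le_nhds
      · filter_upwards [self_mem_nhdsWithin] with w hw
        simpa using hw
    filter_upwards [key 0, ht.eventually (key (0 + K))] with u h1 h2
    rw [h1, h2, hK u]
  intro z
  have h := congrFun hshift (rot * z)
  simp only [add_mul] at h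
  rwa [show rot * z * (√2 * Complex.I) = z by rw [mul_assoc, mul_left_comm, rot_mul, mul_one]] at h

theorem isHalfPeriods {lam α β : ℝ} (hκ0 : 0 < κ) (hlam0 : 0 < lam) (hκ : κ ^ 2 + lam ^ 2 = 1)
    (hα_pos : 0 < α) (hα_lt : α < Real.pi / 2) (hα : κ = Real.cos α)
    (hβ_pos : 0 < β) (hβ_lt : β < Real.pi / 2) (hβ : lam = Real.cos β) (hd : IsD κ d) :
    IsHalfPeriods d (I β) (√2 * I α) := by
  have hκ' : lam ^ 2 + κ ^ 2 = 1 := by rw [add_comm]; exact hκ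
  obtain ⟨S, hS⟩ := exists_isSn hκ hκ0.ne' hlam0.ne'
  obtain ⟨T, hT⟩ := exists_isSn hκ' hlam0.ne' hκ0.ne'
  obtain ⟨d', hd'⟩ := exists_of_isSn hT
  obtain ⟨hK, hKa, hKd, hKpos, -⟩ := hS.exists_turning_point hκ0 hβ_pos hβ_lt hβ hκ
  obtain ⟨hL, hLa, hLd, hLpos, hLpos'⟩ := hT.exists_turning_point hlam0 hα_pos hα_lt hα hκ'
  have hTne : ∀ x ∈ Set.Ioc 0 (I α), T x ≠ 0 := fun x hx h => by
    have := hLpos x hx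
    rw [h] at this
    exact lt_irrefl _ this
  have hpole : d ((√2 * I α : ℝ) * Complex.I) = 0 := by
    have := hd.apply_isogeny_eq_zero hκ hκ0.ne' hlam0.ne' hS hT (hLa _ ⟨hL.le, le_rfl⟩) hLd
      (hTne _ ⟨hL, le_rfl⟩)
    rw [← this]; congr 1; push_cast; ring
  refine isHalfPeriods_of hK (by positivity) (hd.apply_neg hS) (hd.apply_conj hS)
    (hd.periodic_of_deriv_eq_zero hS (hKa _ ⟨hK.le, le_rfl⟩) hKd) ?_ ?_ ?_ ?_
  · have h := hd.periodic_isogeny hκ hlam0.ne' hS hT hd'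
      (hd'.periodic_of_deriv_eq_zero hT (hLa _ ⟨hL.le, le_rfl⟩) hLd)
    convert h using 1
    push_cast; ring
  · intro x hx h
    rw [hd.apply_zero hS, (hd.eventuallyEq_of_analyticAt hS (hKa x ⟨hx.1.le, hx.2⟩)).eq_of_nhds]
      at h
    have h1 : S x = 0 := by
      apply pow_eq_zero_iff two_ne_zero |>.1
      linear_combination -h
    have := hKpos x hx
    rw [h1] at this
    exact lt_irrefl _ this
  · intro x hx h
    rw [hd.apply_zero hS] at h
    have h2 : (0 : ℝ) < √2 := by positivity
    rcases eq_or_lt_of_le hx.2 with h1 | h1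
    · rw [h1, hpole] at h
      exact zero_ne_one h
    · have hu : x / √2 ∈ Set.Ioo 0 (I α) :=
        ⟨div_pos hx.1 h2, by rw [div_lt_iff₀ h2]; linarith⟩
      have hd0 : deriv T (x / √2 : ℝ) ≠ 0 := fun h0 => by
        have := hLpos' _ ⟨hu.1.le, hu.2⟩
        rw [h0] at this
        exact lt_irrefl _ this
      have e := hd.apply_isogeny hκ hlam0.ne' hS hT (hLa _ ⟨hu.1.le, hu.2.le⟩) hd0
      rw [show ((x / √2 : ℝ) : ℂ) * (√2 * Complex.I) = x * Complex.I by
        have := sqrt_two_ne_zero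
        push_cast; field_simp, h] at e
      have : (κ : ℂ) ^ 2 * (T (x / √2 : ℝ) ^ 2 / deriv T (x / √2 : ℝ) ^ 2) ≠ 0 :=
        mul_ne_zero (pow_ne_zero 2 (by exact_mod_cast hκ0.ne'))
          (div_ne_zero (pow_ne_zero 2 (hTne _ ⟨hu.1, hu.2.le⟩)) (pow_ne_zero 2 hd0))
      exact this (by linear_combination -e)
  -- At the real turning point the energy gives d² = (1 - S²)² = λ² ≠ 0, whereas d takes the
  -- conventional value `0` at the pole iK'.
  · rw [hpole, (hd.eventuallyEq_of_analyticAt hS (hKa _ ⟨hK.le, le_rfl⟩)).eq_of_nhds]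
    intro h
    have e := hS.energy (hKa _ ⟨hK.le, le_rfl⟩)
    rw [hKd] at e
    have hκc : (κ : ℂ) ^ 2 + lam ^ 2 = 1 := by exact_mod_cast hκ
    have : (lam : ℂ) ^ 2 = 0 := by linear_combination e + hκc - (1 - S (I β) ^ 2) * h
    exact hlam0.ne' (by exact_mod_cast pow_eq_zero_iff two_ne_zero |>.1 this)

end IsD

theorem existsUnique_isD {κ lam : ℝ} (hκ : κ ^ 2 + lam ^ 2 = 1) (hκ0 : κ ≠ 0) (hlam : lam ≠ 0) :
    ∃! d, IsD κ d := by
  obtain ⟨S, hS⟩ := exists_isSn hκ hκ0 hlam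
  obtain ⟨d, hd⟩ := IsD.exists_of_isSn hS
  exact ⟨d, hd, fun d' hd' => IsD.unique hS hd' hd⟩

end SignatureFour

theorem mainTheorem5 (κ lam α β : ℝ) (hκ_pos : 0 < κ) (hκ_lt : κ < 1)
    (hlam : lam = √(1 - κ ^ 2))
    (hα_pos : 0 < α) (hα_lt : α < Real.pi / 2) (hα : κ = Real.cos α)
    (hβ_pos : 0 < β) (hβ_lt : β < Real.pi / 2) (hβ : lam = Real.cos β) :
    (∃! d : ℂ → ℂ, SignatureFour.IsD κ d) ∧
    (∃! d : ℂ → ℂ, SignatureFour.IsD lam d) ∧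
    ∀ dκ dlam : ℂ → ℂ, SignatureFour.IsD κ dκ → SignatureFour.IsD lam dlam →
      (∃! p : ℝ × ℝ, SignatureFour.IsHalfPeriods dκ p.1 p.2) ∧
      (∃! p : ℝ × ℝ, SignatureFour.IsHalfPeriods dlam p.1 p.2) ∧
      ∀ Kκ Kκ' Klam Klam' : ℝ,
        SignatureFour.IsHalfPeriods dκ Kκ Kκ' → SignatureFour.IsHalfPeriods dlam Klam Klam' →
        (Kκ = SignatureFour.I β ∧ Kκ' = √2 * SignatureFour.I α) ∧
        (Kκ' = √2 * Klam ∧ Klam' = √2 * Kκ) := by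
  have hlam0 : 0 < lam := by rw [hβ]; exact Real.cos_pos_of_mem_Ioo ⟨by linarith, hβ_lt⟩
  have hsq : κ ^ 2 + lam ^ 2 = 1 := by
    rw [hlam, Real.sq_sqrt (by nlinarith)]; ring
  have hsq' : lam ^ 2 + κ ^ 2 = 1 := by rw [add_comm]; exact hsq
  refine ⟨SignatureFour.existsUnique_isD hsq hκ_pos.ne' hlam0.ne',
    SignatureFour.existsUnique_isD hsq' hlam0.ne' hκ_pos.ne', fun dκ dlam hdκ hdlam => ?_⟩
  have h1 := hdκ.isHalfPeriods hκ_pos hlam0 hsq hα_pos hα_lt hα hβ_pos hβ_lt hβ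
  have h2 := hdlam.isHalfPeriods hlam0 hκ_pos hsq' hβ_pos hβ_lt hβ hα_pos hα_lt hα
  refine ⟨⟨(_, _), h1, fun p hp => ?_⟩, ⟨(_, _), h2, fun p hp => ?_⟩, ?_⟩
  · exact Prod.ext (hp.unique h1).1 (hp.unique h1).2
  · exact Prod.ext (hp.unique h2).1 (hp.unique h2).2
  · intro Kκ Kκ' Klam Klam' hK hL
    obtain ⟨rfl, rfl⟩ := hK.unique h1
    obtain ⟨rfl, rfl⟩ := hL.unique h2
    exact ⟨⟨rfl, rfl⟩, rfl, rfl⟩
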